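/- For $n\ge 0$ let $Y_n\subset(\mathbb R^2)^n$ be the set of $n$-tuples of pairwise distinct points of the plane, $X_n=Y_n/S_n$ the configuration space of $n$ indistinguishable particles (with the measure induced by Lebesgue measure), $B_n=\pi_1(X_n,x_0)$ the braid group, where $x_0=\{0,1,\dots,n-1\}\subset\mathbb R\subset\mathbb R^2$, and $\Lambda:\tilde X_n\to X_n$ the universal covering whose points are the homotopy classes of curves in $X_n$ starting at $x_0$; for $x\in\tilde X_n$ and $b\in B_n$ let $xb$ be the class of $b$ followed by $x$. Let $\tau_1,\dots,\tau_{n-1}\in B_n$ be the elementary counterclockwise exchanges of neighbouring particles. A homomorphism $\varepsilon:B_n\to U(1)$ has statistics phase $\kappa$ if $\varepsilon(\tau_1)=\dots=\varepsilon(\tau_{n-1})=\kappa$ (a void condition for $n\le1$); for given $n$ and $\kappa$ there is exactly one such $\varepsilon$. Let $L^2_\kappa(\tilde X_n)$ be the space of measurable $\Psi:\tilde X_n\to\mathbb C$ (up to equality almost everywhere) with $\Psi(xb^{-1})=\varepsilon(b)\Psi(x)$ for which $|\Psi|^2$, regarded as a function on $X_n$, is integrable. Let $\tilde d_n$ be the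 lift to $\tilde X_n$ of the action $d_n$ of $(\mathbb R,+)$ on $X_n$ by counterclockwise rotations, let $s_n\in\mathbb R$, and put $$(D_n(\theta)\Psi)(x)=e^{is_n\theta}\,\Psi(\tilde d_n(-\theta)x),\qquad \Psi\in L^2_\kappa(\tilde X_n).$$ Let $\kappa_n=\varepsilon_{2n}(\beta_n)$ be the statistics phase of the $n$-particle system, where $\varepsilon_{2n}:B_{2n}\to U(1)$ has statistics phase $\kappa$ and $\beta_n\in B_{2n}$ is the braid that exchanges the clusters $\{0,\dots,n-1\}$ and $\{n,\dots,2n-1\}$: the centers of the clusters are rotated counterclockwise by $\pi$ about their midpoint, while each cluster is translated rigidly without rotation about its center. Theorem. Let $\kappa\in U(1)$ and $s\in\mathbb R$ with $e^{2\pi i s}=\kappa$ (the spin-statistics relation of a single particle). Then, for every $n$ and $s_n\in\mathbb R$, the system of $n$ indistinguishable copies satisfies the spin-statistics relation $$D_n(2\pi)=\kappa_n\quad\text{(as operators on } L^2_\kappa(\tilde X_n)\text{)}$$ if and only if $s_n\in ns+\mathbb Z$. -/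

import Mathlib

open MeasureTheory

noncomputable section

namespace Anyon

/-! ### Configuration spaces -/

/-- `Y n`: configurations of `n` distinguishable particles, the `n`-tuples of pairwise distinct
points of the plane, which is identified with `ℂ`. -/
abbrev Y (n : ℕ) : Type := {y : Fin n → ℂ // Function.Injective y}

/-- The right action of a permutation, `(y π) i = y (π i)`. -/
def Y.perm {n : ℕ} (y : Y n) (π : Equiv.Perm (Fin n)) : Y n :=
  ⟨y.1 ∘ π, y.2.comp π.injective⟩

/-- Two configurations are equivalent if they lie in the same orbit of the symmetric group. -/
def permSetoid (n : ℕ) : Setoid (Y n) where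
  r y y' := ∃ π : Equiv.Perm (Fin n), y' = y.perm π
  iseqv :=
    { refl := fun y => ⟨1, rfl⟩
      symm := by
        rintro y _ ⟨π, rfl⟩
        refine ⟨π⁻¹, Subtype.ext (funext fun i => ?_)⟩
        simp [Y.perm]
      trans := by
        rintro y _ _ ⟨π, rfl⟩ ⟨π', rfl⟩
        exact ⟨π * π', rfl⟩ }

/-- `X n = Y n / S n`: configurations of `n` indistinguishable particles, with the quotient
topology and the quotient `σ`-algebra. -/
abbrev X (n : ℕ) : Type := Quotient (permSetoid n)

/-- The orbit map. -/
def proj (n : ℕ) (y : Y n) : X n := Quotient.mk (permSetoid n) y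

/-- The measure on `X n` induced by Lebesgue measure on `Y n ⊆ ℂⁿ`, normalized such that the
integral of `f` over `X n` is `1 / n!` times the integral of the pull-back of `f` to `Y n`. -/
def measX (n : ℕ) : Measure (X n) :=
  ((n.factorial : ENNReal)⁻¹) •
    ((volume : Measure (Fin n → ℂ)).comap (Subtype.val : Y n → (Fin n → ℂ))).map (proj n)

/-- Counterclockwise rotation of `Y n` by the angle `α`. -/
def rotY {n : ℕ} (α : ℝ) (y : Y n) : Y n :=
  ⟨fun i => Complex.exp (α * Complex.I) * y.1 i, fun _ _ h =>
    y.2 (mul_left_cancel₀ (Complex.exp_ne_zero _) h)⟩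

/-- `d_n(α)`: counterclockwise rotation of `X n` by the angle `α`. -/
def rot {n : ℕ} (α : ℝ) : X n → X n :=
  Quotient.map (sa := permSetoid n) (sb := permSetoid n) (rotY α) (by
    rintro y _ ⟨π, rfl⟩
    exact ⟨π, rfl⟩)

lemma rot_proj {n : ℕ} (α : ℝ) (y : Y n) : rot α (proj n y) = proj n (rotY α y) := rfl

lemma rot_zero {n : ℕ} (p : X n) : rot 0 p = p := by
  induction p using Quotient.inductionOn with
  | h y => exact congrArg (proj n) (Subtype.ext (funext fun i => by simp [rotY]))

lemma continuous_proj (n : ℕ) : Continuous (proj n) := continuous_quotient_mk'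

lemma isOpenQuotientMap_proj (n : ℕ) : IsOpenQuotientMap (proj n) where
  surjective := Quotient.mk_surjective
  continuous := continuous_proj n
  isOpenMap := by
    intro U hU
    have hperm : ∀ π : Equiv.Perm (Fin n), Continuous fun y : Y n => y.perm π := by
      intro π
      refine Continuous.subtype_mk (f := fun y : Y n => y.1 ∘ π) (continuous_pi fun i => ?_) _
      exact (continuous_apply (π i)).comp continuous_subtype_val
    have : proj n ⁻¹' (proj n '' U) = ⋃ π : Equiv.Perm (Fin n), (fun y : Y n => y.perm π) ⁻¹' U := by
      ext y
      simp only [Set.mem_preimage, Set.mem_image, Set.mem_iUnion]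
      constructor
      · rintro ⟨z, hz, h⟩
        obtain ⟨π, rfl⟩ := Quotient.exact (s := permSetoid n) h.symm
        exact ⟨π, hz⟩
      · rintro ⟨π, h⟩
        exact ⟨_, h, (Quotient.sound (s := permSetoid n) ⟨π, rfl⟩).symm⟩
    change IsOpen (proj n ⁻¹' (proj n '' U))
    rw [this]
    exact isOpen_iUnion fun π => hU.preimage (hperm π)

lemma continuous_rotY (n : ℕ) : Continuous fun z : ℝ × Y n => rotY z.1 z.2 :=
  Continuous.subtype_mk (continuous_pi fun i => by
    have : Continuous fun z : ℝ × Y n => z.2.1 i :=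
      (continuous_apply i).comp (continuous_subtype_val.comp continuous_snd)
    fun_prop) _

lemma continuous_rot₂ (n : ℕ) : Continuous fun z : ℝ × X n => rot z.1 z.2 := by
  have h := (IsOpenQuotientMap.id (X := ℝ)).prodMap (isOpenQuotientMap_proj n)
  rw [h.isQuotientMap.continuous_iff]
  exact (continuous_proj n).comp (continuous_rotY n)

lemma continuous_rot {n : ℕ} (α : ℝ) : Continuous (rot α : X n → X n) :=
  (continuous_rot₂ n).comp (by fun_prop : Continuous fun p : X n => (α, p))

lemma measurable_proj (n : ℕ) : Measurable (proj n) := measurable_quotient_mk''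

lemma isOpen_injective (n : ℕ) : IsOpen {y : Fin n → ℂ | Function.Injective y} := by
  have : {y : Fin n → ℂ | Function.Injective y} =
      ⋂ i : Fin n, ⋂ j : Fin n, {y | y i = y j → i = j} := by
    ext y; simp [Function.Injective]
  rw [this]
  refine isOpen_iInter_of_finite fun i => isOpen_iInter_of_finite fun j => ?_
  by_cases h : i = j
  · simp [h]
  · simp only [h, imp_false]
    exact isOpen_ne_fun (continuous_apply i) (continuous_apply j)

lemma measurePreserving_rotY {n : ℕ} (α : ℝ) :
    MeasurePreserving (rotY α : Y n → Y n)
      ((volume : Measure (Fin n → ℂ)).comap Subtype.val)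
      ((volume : Measure (Fin n → ℂ)).comap Subtype.val) := by
  have hm : MeasurableSet {y : Fin n → ℂ | Function.Injective y} := (isOpen_injective n).measurableSet
  have hc : MeasurePreserving (fun z : ℂ => Complex.exp (α * Complex.I) * z) := by
    have h := (rotation (Circle.exp α)).measurePreserving
    convert h using 2 with z
    simp [rotation_apply, Circle.coe_exp]
  have hpi : MeasurePreserving
      (fun (y : Fin n → ℂ) (i : Fin n) => Complex.exp (α * Complex.I) * y i) :=
    volume_preserving_pi (fun _ => hc)
  have hmeas : Measurable (rotY α : Y n → Y n) :=
    ((continuous_rotY n).comp (by fun_prop : Continuous fun p : Y n => (α, p))).measurable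
  refine ⟨hmeas, Measure.ext fun s hs => ?_⟩
  have he : MeasurableEmbedding (Subtype.val : Y n → (Fin n → ℂ)) :=
    MeasurableEmbedding.subtype_coe hm
  rw [Measure.map_apply hmeas hs, he.comap_apply, he.comap_apply,
    ← hpi.measure_preimage (he.measurableSet_image.2 hs).nullMeasurableSet]
  congr 1
  ext y
  simp only [Set.mem_image, Set.mem_preimage]
  constructor
  · rintro ⟨z, hz, rfl⟩
    exact ⟨_, hz, rfl⟩
  · rintro ⟨z, hz, h⟩
    have hy : Function.Injective y := fun i j hij => z.2 (by rw [h]; simp [hij])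
    refine ⟨⟨y, hy⟩, ?_, rfl⟩
    have : rotY α ⟨y, hy⟩ = z := Subtype.ext h.symm
    rwa [this]

lemma measurePreserving_rot {n : ℕ} (α : ℝ) :
    MeasurePreserving (rot α : X n → X n) (measX n) (measX n) := by
  have hmeas : Measurable (rot α : X n → X n) :=
    measurable_from_quotient.2 ((measurable_proj n).comp (measurePreserving_rotY α).measurable)
  refine ⟨hmeas, ?_⟩
  rw [measX, Measure.map_smul, Measure.map_map hmeas (measurable_proj n)]
  have : (rot α : X n → X n) ∘ proj n = proj n ∘ rotY α := rfl
  rw [this, ← Measure.map_map (measurable_proj n) (measurePreserving_rotY α).measurable,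
    (measurePreserving_rotY α).map_eq]

/-! ### The universal covering space and the braid group -/

/-- The base point of `X n`: the particles sit at `0, 1, …, n - 1` on the real axis. -/
def baseY (n : ℕ) : Y n :=
  ⟨fun k => ((k : ℕ) : ℂ), fun _ _ h => Fin.ext (Nat.cast_injective (R := ℂ) h)⟩

/-- The base point of `X n`. -/
def base (n : ℕ) : X n := proj n (baseY n)

/-- The braid group `B n`, the fundamental group of `X n`. In Mathlib's convention the product
`b * c` is the class of `c` followed by `b`. -/
abbrev Braid (n : ℕ) : Type := FundamentalGroup (X n) (base n)

/-- The universal covering space of `X n`: homotopy classes (with fixed end points) of curves in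
`X n` that start at the base point. -/
def Cover (n : ℕ) : Type := Σ p : X n, Path.Homotopic.Quotient (base n) p

/-- The covering map `Λ`, which sends the class of a curve to its end point. -/
def Cover.proj {n : ℕ} (x : Cover n) : X n := x.1

/-- The class of a curve that represents `x`, followed by the curve `γ`. -/
def Cover.extend {n : ℕ} (x : Cover n) {q : X n} (γ : Path x.proj q) : Cover n :=
  ⟨q, x.2.trans (Path.Homotopic.Quotient.mk γ)⟩

/-- The right action of the braid group: `x b` is the class of the loop `b` followed by a curve
that represents `x`. -/
def Cover.act {n : ℕ} (x : Cover n) (b : Braid n) : Cover n :=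
  ⟨x.1, Path.Homotopic.Quotient.trans (FundamentalGroup.toPath b) x.2⟩

/-- The sheet over `V` through `x`: all points that are reached from `x` along curves in `V`. -/
def Cover.sheet {n : ℕ} (x : Cover n) (V : Set (X n)) : Set (Cover n) :=
  {z | ∃ (q : X n) (γ : Path x.proj q), (∀ t, γ t ∈ V) ∧ z = x.extend γ}

/-- The topology of the universal covering space, generated by the sheets over open sets. -/
instance (n : ℕ) : TopologicalSpace (Cover n) :=
  TopologicalSpace.generateFrom
    {S | ∃ (x : Cover n) (V : Set (X n)), IsOpen V ∧ S = x.sheet V}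

/-- The Borel `σ`-algebra of the universal covering space. -/
instance (n : ℕ) : MeasurableSpace (Cover n) := borel (Cover n)

instance (n : ℕ) : BorelSpace (Cover n) := ⟨rfl⟩

/-- The curve `t ↦ d_n(t α) p`, for `0 ≤ t ≤ 1`, from `p` to `d_n(α) p`. -/
def rotPath {n : ℕ} (α : ℝ) (p : X n) : Path p (rot α p) where
  toFun t := rot ((t : ℝ) * α) p
  continuous_toFun := (continuous_rot₂ n).comp
    (by fun_prop : Continuous fun t : unitInterval => ((t : ℝ) * α, p))
  source' := by simp [rot_zero]
  target' := by simp

/-- The lift `d̃_n(α)` of `d_n(α)`: the end point of the lift, starting at `x`, of the curve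
`t ↦ d_n(t α) Λ(x)`. -/
def Cover.rot {n : ℕ} (α : ℝ) (x : Cover n) : Cover n := x.extend (rotPath α x.proj)

lemma Cover.proj_rot {n : ℕ} (α : ℝ) (x : Cover n) :
    (Cover.rot α x).proj = Anyon.rot α x.proj := rfl

lemma Cover.rot_act {n : ℕ} (α : ℝ) (x : Cover n) (b : Braid n) :
    Cover.rot α (x.act b) = (Cover.rot α x).act b := by
  obtain ⟨p, ξ⟩ := x
  obtain ⟨β, rfl⟩ := Path.Homotopic.Quotient.mk_surjective b
  obtain ⟨ξ, rfl⟩ := Path.Homotopic.Quotient.mk_surjective ξ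
  refine congrArg (Sigma.mk (Anyon.rot α p)) (Path.Homotopic.Quotient.eq.2 ?_)
  exact ⟨Path.Homotopy.transAssoc _ _ _⟩

lemma square_homotopic {n : ℕ} (α : ℝ) {p q : X n} (γ : Path p q) :
    (γ.trans (rotPath α q)).Homotopic
      ((rotPath α p).trans (γ.map (continuous_rot α))) := by
  let F : C(ℝ × ℝ, X n) :=
    ⟨fun z => rot (z.1 * α) (γ.extend z.2), (continuous_rot₂ n).comp
      (by fun_prop : Continuous fun z : ℝ × ℝ => (z.1 * α, γ.extend z.2))⟩
  have key : ∀ P Q : Path ((0 : ℝ), (0 : ℝ)) (1, 1), P.Homotopic Q := fun P Q =>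
    SimplyConnectedSpace.paths_homotopic P Q
  let a : Path ((0 : ℝ), (0 : ℝ)) (0, 1) := ⟨⟨fun t => (0, (t : ℝ)), by fun_prop⟩, by simp, by simp⟩
  let b : Path ((0 : ℝ), (1 : ℝ)) (1, 1) := ⟨⟨fun t => ((t : ℝ), 1), by fun_prop⟩, by simp, by simp⟩
  let c : Path ((0 : ℝ), (0 : ℝ)) (1, 0) := ⟨⟨fun t => ((t : ℝ), 0), by fun_prop⟩, by simp, by simp⟩
  let d : Path ((1 : ℝ), (0 : ℝ)) (1, 1) := ⟨⟨fun t => (1, (t : ℝ)), by fun_prop⟩, by simp, by simp⟩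
  have h := (key (a.trans b) (c.trans d)).map F
  have h0 : p = F (0, 0) := by simp [F, rot_zero]
  have h1 : rot α q = F (1, 1) := by simp [F]
  have h' := h.pathCast h0 h1
  convert h' using 1
  · ext t
    simp only [Path.cast_coe, Path.map_coe, Function.comp, Path.trans_apply]
    split_ifs with h2
    · simp only [F, a, ContinuousMap.coe_mk, Path.coe_mk', zero_mul, rot_zero]
      exact (γ.extend_apply ((unitInterval.mul_pos_mem_iff zero_lt_two).2 ⟨t.2.1, h2⟩)).symm
    · simp [F, b, rotPath]
  · ext t
    simp only [Path.cast_coe, Path.map_coe, Function.comp, Path.trans_apply]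
    split_ifs with h2
    · simp [F, c, rotPath]
    · simp only [F, d, ContinuousMap.coe_mk, Path.coe_mk', one_mul]
      exact congrArg (rot α) (γ.extend_apply
        (unitInterval.two_mul_sub_one_mem_iff.2 ⟨(not_le.1 h2).le, t.2.2⟩)).symm

lemma Cover.rot_extend {n : ℕ} (α : ℝ) (x : Cover n) {q : X n} (γ : Path x.proj q) :
    Cover.rot α (x.extend γ) = (Cover.rot α x).extend (γ.map (continuous_rot α)) := by
  obtain ⟨p, ξ⟩ := x
  obtain ⟨ξ, rfl⟩ := Path.Homotopic.Quotient.mk_surjective ξ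
  refine congrArg (Sigma.mk (Anyon.rot α q)) (Path.Homotopic.Quotient.eq.2 ?_)
  exact (Path.Homotopic.trans ⟨Path.Homotopy.transAssoc _ _ _⟩
    ((Path.Homotopic.refl ξ).hcomp (square_homotopic α γ))).trans
    (Path.Homotopic.symm ⟨Path.Homotopy.transAssoc _ _ _⟩)

lemma Cover.extend_extend {n : ℕ} (x : Cover n) {q r : X n} (γ : Path x.proj q) (δ : Path q r) :
    (x.extend γ).extend δ = x.extend (γ.trans δ) := by
  obtain ⟨p, ξ⟩ := x
  obtain ⟨ξ, rfl⟩ := Path.Homotopic.Quotient.mk_surjective ξ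
  refine congrArg (Sigma.mk r) (Path.Homotopic.Quotient.eq.2 ?_)
  exact ⟨Path.Homotopy.transAssoc _ _ _⟩

lemma Cover.mem_sheet {n : ℕ} (x : Cover n) {V : Set (X n)} (h : x.proj ∈ V) : x ∈ x.sheet V := by
  refine ⟨_, Path.refl _, fun _ => h, ?_⟩
  obtain ⟨p, ξ⟩ := x
  obtain ⟨ξ, rfl⟩ := Path.Homotopic.Quotient.mk_surjective ξ
  refine congrArg (Sigma.mk p) (Path.Homotopic.Quotient.eq.2 ?_)
  exact ⟨(Path.Homotopy.transRefl _).symm⟩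

lemma Cover.isOpen_sheet {n : ℕ} (x : Cover n) {V : Set (X n)} (hV : IsOpen V) :
    IsOpen (x.sheet V) :=
  TopologicalSpace.isOpen_generateFrom_of_mem ⟨x, V, hV, rfl⟩

lemma Cover.continuous_rot {n : ℕ} (α : ℝ) : Continuous (Cover.rot α : Cover n → Cover n) := by
  refine continuous_generateFrom_iff.2 ?_
  rintro _ ⟨z, V, hV, rfl⟩
  rw [isOpen_iff_forall_mem_open]
  rintro x ⟨q, δ, hδ, hx⟩
  have hq : q = Anyon.rot α x.proj := (congrArg Cover.proj hx).symm
  subst hq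
  refine ⟨x.sheet (Anyon.rot α ⁻¹' V), ?_, x.isOpen_sheet (hV.preimage (Anyon.continuous_rot α)),
    x.mem_sheet ?_⟩
  · rintro _ ⟨r, γ, hγ, rfl⟩
    refine ⟨_, δ.trans (γ.map (Anyon.continuous_rot α)), fun t => ?_, ?_⟩
    · rw [Path.trans_apply]
      split_ifs
      · exact hδ _
      · exact hγ _
    · rw [Cover.rot_extend, ← Cover.extend_extend]
      have : ∀ (w w' : Cover n) (h : w = w') (hp : w.proj = w'.proj) (u : X n)
          (η : Path w.proj u), w.extend η = w'.extend (η.cast hp.symm rfl) := by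
        rintro w _ rfl _ u η
        rfl
      exact this _ _ hx rfl _ _
  · have := hδ 1
    rwa [δ.target] at this

/-! ### Statistics -/

/-- The factor `(1 - e^{iπt}) / 2`, which runs from `0` to `1` along a half circle below the real
axis. -/
def halfTurn (t : ℝ) : ℂ := (1 - Complex.exp (Real.pi * t * Complex.I)) / 2

/-- The elementary exchange of the particles `i` and `i + 1` (counted from `0`) of the base
configuration: they are rotated counterclockwise by `π` about their midpoint, while all other
particles stay where they are. -/
def exchangeY (n i : ℕ) (t : ℝ) (k : Fin n) : ℂ :=
  if (k : ℕ) = i then (k : ℕ) + halfTurn t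
  else if (k : ℕ) = i + 1 then (k : ℕ) - halfTurn t
  else (k : ℕ)

/-- The exchange of two clusters of `n` particles each, at `0, …, n - 1` and `n, …, 2 n - 1`: the
centers of the clusters are rotated counterclockwise by `π` about their midpoint, while each
cluster is translated as a rigid body, without rotation about its center. -/
def clusterY (n : ℕ) (t : ℝ) (k : Fin (2 * n)) : ℂ :=
  if (k : ℕ) < n then (k : ℕ) + n * halfTurn t else (k : ℕ) - n * halfTurn t

lemma halfTurn_zero : halfTurn 0 = 0 := by simp [halfTurn]

lemma halfTurn_one : halfTurn 1 = 1 := by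
  norm_num [halfTurn, Complex.exp_pi_mul_I]

lemma continuous_halfTurn : Continuous halfTurn := by
  unfold halfTurn; fun_prop

lemma halfTurn_eq_int {t : ℝ} {N m : ℤ} (h : 2 * (N : ℂ) * halfTurn t = m) :
    (N - m) ^ 2 = N ^ 2 := by
  have h1 : (N : ℂ) * Complex.exp ((Real.pi * t : ℝ) * Complex.I) = ((N - m : ℤ) : ℂ) := by
    push_cast
    rw [← h, halfTurn]
    ring
  have h2 := congrArg norm h1
  rw [norm_mul, Complex.norm_exp_ofReal_mul_I, mul_one, Complex.norm_intCast,
    Complex.norm_intCast] at h2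
  have h3 : |N| = |N - m| := by exact_mod_cast h2
  exact (sq_eq_sq_iff_abs_eq_abs _ _).2 h3.symm

lemma exchangeY_injective {n i : ℕ} (t : ℝ) : Function.Injective (exchangeY n i t) := by
  have key : ∀ m : ℤ, halfTurn t = m → m = 0 ∨ m = 1 := by
    intro m h
    have := halfTurn_eq_int (t := t) (N := 1) (m := 2 * m) (by push_cast; rw [h]; ring)
    have h3 : m * (m - 1) = 0 := by nlinarith
    rcases mul_eq_zero.1 h3 with h3 | h3
    · exact Or.inl h3
    · exact Or.inr (by linarith)
  have key2 : 2 * halfTurn t ≠ 1 := by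
    intro h
    have := halfTurn_eq_int (t := t) (N := 1) (m := 1) (by push_cast; rw [mul_one, h])
    norm_num at this
  have hA : ∀ k : ℕ, (i : ℂ) + halfTurn t = k → k = i ∨ k = i + 1 := by
    intro k h
    have := key ((k : ℤ) - i) (by push_cast; linear_combination h)
    omega
  have hB : ∀ k : ℕ, ((i + 1 : ℕ) : ℂ) - halfTurn t = k → k = i ∨ k = i + 1 := by
    intro k h
    have := key ((i : ℤ) + 1 - k) (by push_cast at h ⊢; linear_combination -h)
    omega
  have hC : (i : ℂ) + halfTurn t ≠ ((i + 1 : ℕ) : ℂ) - halfTurn t := by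
    intro h
    exact key2 (by push_cast at h; linear_combination h)
  intro k l h
  apply Fin.ext
  unfold exchangeY at h
  split_ifs at h with h1 h2 h3 h4 h5 h6 h7
  · omega
  · exact absurd (by rwa [h1, h3] at h) hC
  · rw [h1] at h
    have := hA _ h
    omega
  · exact absurd (by rwa [h4, h5, eq_comm] at h) hC
  · omega
  · rw [h4] at h
    have := hB _ h
    omega
  · rw [h7, eq_comm] at h
    have := hA _ h
    omega
  all_goals first
    | exact Nat.cast_injective (R := ℂ) h
    | (rename_i h8
       rw [h8, eq_comm] at h
       have := hB _ h
       omega)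

lemma clusterY_injective {n : ℕ} (t : ℝ) : Function.Injective (clusterY n t) := by
  have key : ∀ k l : Fin (2 * n), (k : ℕ) < n → ¬ (l : ℕ) < n →
      ((k : ℕ) : ℂ) + n * halfTurn t ≠ ((l : ℕ) : ℂ) - n * halfTurn t := by
    intro k l hk hl h
    have h1 := halfTurn_eq_int (t := t) (N := n) (m := (l : ℕ) - (k : ℕ))
      (by push_cast; linear_combination h)
    have h2 : (((l : ℕ) : ℤ) - (k : ℕ)) * (((l : ℕ) : ℤ) - (k : ℕ) - 2 * n) = 0 := by
      linear_combination h1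
    have := l.2
    rcases mul_eq_zero.1 h2 with h3 | h3 <;> omega
  intro k l h
  apply Fin.ext
  unfold clusterY at h
  split_ifs at h with h1 h2 h3
  · exact Nat.cast_injective (R := ℂ) (add_right_cancel h)
  · exact absurd h (key k l h1 h2)
  · exact absurd h.symm (key l k h3 h1)
  · exact Nat.cast_injective (R := ℂ) (sub_left_injective h)

/-- The braid of a motion of the base configuration that ends at a permutation of it. -/
def braidOf {n : ℕ} (f : ℝ → Fin n → ℂ) (hf : ∀ k, Continuous fun t => f t k)
    (hinj : ∀ t, Function.Injective (f t)) (h0 : f 0 = (baseY n).1)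
    (π : Equiv.Perm (Fin n)) (h1 : f 1 = (baseY n).1 ∘ π) : Braid n :=
  FundamentalGroup.fromPath <| Path.Homotopic.Quotient.mk
    { toFun := fun t => proj n ⟨f t, hinj t⟩
      continuous_toFun := (continuous_proj n).comp
        (Continuous.subtype_mk (continuous_pi fun k => (hf k).comp continuous_subtype_val) _)
      source' := congrArg (proj n) (Subtype.ext (by simpa using h0))
      target' := (Quotient.sound (s := permSetoid n)
        ⟨π, Subtype.ext (by simpa [Y.perm] using h1)⟩).symm }

/-- The generator `τ_{i+1}` of the braid group `B n`, the class of the elementary counterclockwise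
exchange of the particles `i` and `i + 1` (counted from `0`). -/
def exchange (n i : ℕ) (hi : i + 1 < n) : Braid n :=
  braidOf (exchangeY n i)
    (fun k => by
      have := continuous_halfTurn
      unfold exchangeY
      split_ifs <;> fun_prop)
    exchangeY_injective
    (by ext k; simp [exchangeY, halfTurn_zero, baseY])
    (Equiv.swap ⟨i, by omega⟩ ⟨i + 1, hi⟩)
    (by
      ext k
      simp only [exchangeY, halfTurn_one, baseY, Function.comp, Equiv.swap_apply_def, Fin.ext_iff]
      split_ifs <;> simp_all)

/-- The interchange of the first `n` with the last `n` of `2 n` positions. -/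
def clusterSwap (n : ℕ) (k : Fin (2 * n)) : Fin (2 * n) :=
  if h : (k : ℕ) < n then ⟨k + n, by omega⟩ else ⟨k - n, by omega⟩

lemma clusterSwap_involutive (n : ℕ) : Function.Involutive (clusterSwap n) := by
  intro k
  have := k.2
  apply Fin.ext
  unfold clusterSwap
  by_cases h : (k : ℕ) < n
  · simp [h]
  · have h' : (k : ℕ) - n < n := by omega
    simp only [h, h', dite_true, dite_false]
    omega

/-- The braid in `B (2 n)` that exchanges two clusters of `n` particles each. -/
def clusterExchange (n : ℕ) : Braid (2 * n) :=
  braidOf (clusterY n)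
    (fun k => by
      have := continuous_halfTurn
      unfold clusterY
      split_ifs <;> fun_prop)
    clusterY_injective
    (by ext k; simp [clusterY, halfTurn_zero, baseY])
    ((clusterSwap_involutive n).toPerm (clusterSwap n))
    (by
      ext k
      have h2 : ((clusterSwap n k : ℕ) : ℂ) =
          if (k : ℕ) < n then ((k : ℕ) : ℂ) + n else ((k : ℕ) : ℂ) - n := by
        unfold clusterSwap
        split_ifs with h
        · simp
        · exact Nat.cast_sub (not_lt.1 h)
      simp only [clusterY, halfTurn_one, baseY, Function.comp, mul_one]
      exact h2.symm)

/-- The scalar unitary representation `ε` of `B n` has statistics phase `κ`: if `n ≥ 2`, then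
`ε(τ_1) = κ`. (The generators `τ_i` are all conjugate, so the other ones have the same value.) -/
def HasStatisticsPhase {n : ℕ} (ε : Braid n →* Circle) (κ : Circle) : Prop :=
  ∀ h : 0 + 1 < n, ε (exchange n 0 h) = κ

/-- The statistics phase `κ_n` of a system of `n` particles, where `ε` is the representation of
`B (2 n)` that describes two such systems: the phase of the exchange of the two systems. -/
def clusterPhase {n : ℕ} (ε : Braid (2 * n) →* Circle) : Circle := ε (clusterExchange n)

/-! ### Wave functions -/

/-- The square-integrable `ε`-equivariant functions on the universal covering space: Borel
functions `Ψ` with `Ψ (x b⁻¹) = ε(b) Ψ(x)` for which the function on `X n` that `|Ψ|²` descends to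
has finite (upper) integral. -/
def waveFun {n : ℕ} (ε : Braid n →* Circle) : Submodule ℂ (Cover n → ℂ) where
  carrier := {Ψ | Measurable Ψ ∧ (∀ (b : Braid n) (x : Cover n), Ψ (x.act b⁻¹) = ε b * Ψ x) ∧
    ∃ ρ : X n → ENNReal, Measurable ρ ∧ (∀ x : Cover n, ‖Ψ x‖ₑ ^ 2 ≤ ρ x.proj) ∧
      ∫⁻ p, ρ p ∂(measX n) < ⊤}
  zero_mem' := ⟨measurable_const, fun _ _ => by simp, 0, measurable_const, fun _ => by simp,
    by simp⟩
  add_mem' := by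
    rintro Ψ Φ ⟨hΨ, eΨ, ρ, hρ, bρ, iρ⟩ ⟨hΦ, eΦ, ρ', hρ', bρ', iρ'⟩
    refine ⟨hΨ.add hΦ, fun b x => ?_, fun p => 2 * (ρ p + ρ' p), (hρ.add hρ').const_mul 2,
      fun x => ?_, ?_⟩
    · simp only [Pi.add_apply, eΨ, eΦ, mul_add]
    · have h : ‖Ψ x + Φ x‖ₑ ^ 2 ≤ 2 * (‖Ψ x‖ₑ ^ 2 + ‖Φ x‖ₑ ^ 2) := by
        calc ‖Ψ x + Φ x‖ₑ ^ 2 ≤ (‖Ψ x‖ₑ + ‖Φ x‖ₑ) ^ 2 := by gcongr; exact enorm_add_le _ _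
          _ ≤ 2 * (‖Ψ x‖ₑ ^ 2 + ‖Φ x‖ₑ ^ 2) := by
            have := ENNReal.rpow_add_le_mul_rpow_add_rpow ‖Ψ x‖ₑ ‖Φ x‖ₑ (one_le_two (α := ℝ))
            norm_num at this
            exact_mod_cast this
      exact h.trans (mul_le_mul_right (add_le_add (bρ x) (bρ' x)) 2)
    · have h := lintegral_const_mul (μ := measX n) 2 (hρ.add hρ')
      simp only [Pi.add_apply] at h
      rw [h, lintegral_add_left hρ]
      exact ENNReal.mul_lt_top (by simp) (ENNReal.add_lt_top.2 ⟨iρ, iρ'⟩)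
  smul_mem' := by
    rintro c Ψ ⟨hΨ, eΨ, ρ, hρ, bρ, iρ⟩
    refine ⟨hΨ.const_smul c, fun b x => ?_, fun p => ‖c‖ₑ ^ 2 * ρ p, hρ.const_mul _,
      fun x => ?_, ?_⟩
    · simp only [Pi.smul_apply, smul_eq_mul, eΨ]
      ring
    · simp only [Pi.smul_apply, smul_eq_mul, enorm_mul, mul_pow]
      gcongr
      exact bρ x
    · rw [lintegral_const_mul _ hρ]
      exact ENNReal.mul_lt_top (by simp) iρ

/-- The wave functions that vanish almost everywhere. As the fibers of the covering map are
countable, this means that they vanish on the fiber over almost every point of `X n`. -/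
def nullFun {n : ℕ} (ε : Braid n →* Circle) : Submodule ℂ (waveFun ε) where
  carrier := {Ψ | ∀ᵐ p ∂(measX n), ∀ x : Cover n, x.proj = p → Ψ.1 x = 0}
  zero_mem' := by
    rw [Set.mem_ofPred_eq]
    exact Filter.Eventually.of_forall fun _ _ _ => rfl
  add_mem' := by
    intro Ψ Φ hΨ hΦ
    rw [Set.mem_ofPred_eq] at hΨ hΦ ⊢
    filter_upwards [hΨ, hΦ] with p h h' x hx
    simp [h x hx, h' x hx]
  smul_mem' := by
    intro c Ψ hΨ
    rw [Set.mem_ofPred_eq] at hΨ ⊢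
    filter_upwards [hΨ] with p h x hx
    simp [h x hx]

/-- The space `L²_ε` of wave functions on the universal covering space of `X n`: square-integrable
`ε`-equivariant functions up to equality almost everywhere. -/
abbrev L2 {n : ℕ} (ε : Braid n →* Circle) : Type := waveFun ε ⧸ nullFun ε

/-- The map `Ψ ↦ (x ↦ e^{i s θ} Ψ(d̃_n(-θ) x))` on functions. -/
def rotFun {n : ℕ} (ε : Braid n →* Circle) (s θ : ℝ) : waveFun ε →ₗ[ℂ] waveFun ε where
  toFun Ψ := ⟨fun x => Complex.exp (Complex.I * s * θ) * Ψ.1 (Cover.rot (-θ) x), by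
    obtain ⟨Ψ, hΨ, eΨ, ρ, hρ, bρ, iρ⟩ := Ψ
    refine ⟨(hΨ.comp (Cover.continuous_rot (-θ)).measurable).const_mul _, fun b x => ?_,
      fun p => ρ (rot (-θ) p), hρ.comp (measurePreserving_rot (-θ)).measurable, fun x => ?_, ?_⟩
    · simp only [Cover.rot_act, eΨ]
      ring
    · have h : ‖Complex.exp (Complex.I * s * θ)‖ₑ = 1 := by
        rw [← ofReal_norm, mul_assoc, mul_comm, ← Complex.ofReal_mul,
          Complex.norm_exp_ofReal_mul_I, ENNReal.ofReal_one]
      rw [enorm_mul, h, one_mul]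
      exact bρ _
    · rwa [(measurePreserving_rot (-θ)).lintegral_comp hρ]⟩
  map_add' Ψ Φ := Subtype.ext (funext fun x => by simp [mul_add])
  map_smul' c Ψ := Subtype.ext (funext fun x => by simp; ring)

/-- The action `D_n(θ)` of the universal covering group `(ℝ, +)` of `SO(2)` on wave functions,
`D_n(θ) Ψ(x) = e^{i s θ} Ψ(d̃_n(-θ) x)`, for a system with spin parameter `s`. -/
def D {n : ℕ} (ε : Braid n →* Circle) (s θ : ℝ) : L2 ε →ₗ[ℂ] L2 ε :=
  (nullFun ε).mapQ (nullFun ε) (rotFun ε s θ) (by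
    intro Ψ hΨ
    have h := (measurePreserving_rot (n := n) (-θ)).quasiMeasurePreserving.ae hΨ
    filter_upwards [h] with p hp x hx
    have : Ψ.1 (Cover.rot (-θ) x) = 0 := hp _ (by rw [Cover.proj_rot, hx])
    simp [rotFun, this])

end Anyon

end

/-! Both operators are scalars: `D_n(2π)` is `e^{2πi s_n} κ^{n(n-1)}` and the cluster phase is
`κ^{n²}`. Since the space of wave functions is nonzero, they agree iff `e^{2πi s_n} = κ^n = e^{2πi n
s}`, that is, iff `s_n - n s` is an integer.

The exponents count crossings, and no presentation of the braid group is needed for the count. As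
the circle is commutative, `ε` extends to a multiplicative phase on the fundamental groupoid
(`phase_trans`, `phase_fromPath`). Over the contractible set `starSet` of numbered configurations
this phase has a potential `g` (`exists_isStarPhase`). All renumberings of the base configuration
lie in this set, and an elementary exchange stays in it if the numbers of the two particles are in
increasing order. Hence sorting a permutation gives `g (base ∘ σ) = κ^inv(σ) g (base)`
(`IsStarPhase.perm`). The cluster exchange inverts the `n²` pairs across the clusters
(`clusterPhase_eq`); each half of the full rotation inverts all `n(n-1)/2` pairs
(`phase_rotPath_two_pi`).

On the covering space, the rotation by `-2π` is the action of a braid (`Cover.rot_neg_two_pi`), so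
equivariance turns it into a scalar (`D_two_pi`). Nontriviality comes from the wave function
`localFun`, built from `g` near the base point. -/

noncomputable section

namespace Anyon

/-! ### Extension of a representation of the braid group to the fundamental groupoid -/

section Phase

variable {n : ℕ} (ε : Braid n →* Circle)

/-- A curve from the base point to `p`. -/
def joinClass {p : X n} (h : Joined (base n) p) : Path.Homotopic.Quotient (base n) p :=
  .mk h.somePath

open Classical in
/-- An extension of the representation `ε` to the fundamental groupoid of `X n`. -/
def phase {p q : X n} (γ : Path.Homotopic.Quotient p q) : Circle :=
  if h : Joined (base n) p then
    ε (FundamentalGroup.fromPath (((joinClass h).trans γ).trans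
      (joinClass (h.trans (Nonempty.intro γ.out))).symm))
  else 1

lemma phase_trans {p q r : X n} (γ : Path.Homotopic.Quotient p q)
    (δ : Path.Homotopic.Quotient q r) : phase ε (γ.trans δ) = phase ε γ * phase ε δ := by
  by_cases h : Joined (base n) p
  · have h' : Joined (base n) q := h.trans ⟨γ.out⟩
    -- The product of braids composes curves in the opposite order to `trans`; commutativity of the
    -- circle absorbs this.
    rw [phase, phase, phase, dif_pos h, dif_pos h, dif_pos h', mul_comm, ← map_mul,
      FundamentalGroup.mul_def]
    congr 1
    simp only [Path.Homotopic.Quotient.trans_assoc]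
    rw [← Path.Homotopic.Quotient.trans_assoc (joinClass _).symm,
      Path.Homotopic.Quotient.symm_trans, Path.Homotopic.Quotient.refl_trans]
  · have h' : ¬ Joined (base n) q := fun h' => h (h'.trans (Joined.symm ⟨γ.out⟩))
    rw [phase, phase, phase, dif_neg h, dif_neg h, dif_neg h', mul_one]

lemma phase_fromPath (γ : Path.Homotopic.Quotient (base n) (base n)) :
    phase ε γ = ε (FundamentalGroup.fromPath γ) := by
  have h : Joined (base n) (base n) := Joined.refl _
  -- The chosen curve from the base point to itself need not be trivial, so `b` appears conjugated
  -- by its class.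
  let j : Braid n := joinClass h
  let b : Braid n := γ
  rw [phase, dif_pos h]
  change ε (j⁻¹ * (b * j)) = ε b
  rw [map_mul, map_mul, map_inv, mul_comm (ε b), inv_mul_cancel_left]

/-- The phase depends on the underlying function of the curve only. -/
lemma phase_congr {p q p' q' : X n} {γ : Path p q} {γ' : Path p' q'} (h : ∀ t, γ t = γ' t) :
    phase ε (.mk γ) = phase ε (.mk γ') := by
  obtain rfl : p = p' := by simpa using h 0
  obtain rfl : q = q' := by simpa using h 1
  obtain rfl : γ = γ' := Path.ext (funext h)
  rfl

/-- The phase of a curve in `Y n`. -/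
def phaseY {y y' : Y n} (γ : Path y y') : Circle := phase ε (.mk (γ.map (continuous_proj n)))

lemma phaseY_trans {y y' y'' : Y n} (γ : Path y y') (δ : Path y' y'') :
    phaseY ε (γ.trans δ) = phaseY ε γ * phaseY ε δ := by
  rw [phaseY, Path.map_trans, Path.Homotopic.Quotient.mk_trans, phase_trans]; rfl

/-- The phase of a curve is invariant under renumbering of the particles. -/
lemma phaseY_eq_of_perm {y y' z z' : Y n} (γ : Path y y') (δ : Path z z')
    (σ : Equiv.Perm (Fin n)) (h : ∀ t, δ t = (γ t).perm σ) : phaseY ε δ = phaseY ε γ := by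
  refine phase_congr ε fun t => ?_
  simp only [Path.map_coe, Function.comp, h]
  exact (Quotient.sound (s := permSetoid n) ⟨σ, rfl⟩).symm

end Phase

/-! ### A star-shaped set of configurations -/

/-- The configurations such that no difference `y j - y i` with `i < j` lies on the closed ray of
the negative imaginary axis. -/
def starSet (n : ℕ) : Set (Fin n → ℂ) :=
  {y | ∀ i j, i < j → 0 < (y j - y i).im ∨ (y j - y i).re ≠ 0}

lemma injective_of_mem_starSet {n : ℕ} {y : Fin n → ℂ} (h : y ∈ starSet n) :
    Function.Injective y := by
  intro i j hij
  by_contra hne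
  rcases lt_or_gt_of_ne hne with hlt | hlt
  · have := h _ _ hlt
    simp [hij] at this
  · have := h _ _ hlt
    simp [hij] at this

/-- The center has particle `k` at height `k` on the imaginary axis, so its differences point
straight up. Moving towards it rescales the real part of each difference and adds a nonnegative
imaginary part when `i < j`, hence never reaches the forbidden ray. -/
lemma starConvex_starSet (n : ℕ) :
    StarConvex ℝ (fun k : Fin n => ((k : ℕ) : ℂ) * Complex.I) (starSet n) := by
  intro y hy a b ha hb hab i j hij
  have hij' : ((i : ℕ) : ℝ) < ((j : ℕ) : ℝ) := by exact_mod_cast hij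
  have him : ((a • (fun k : Fin n => ((k : ℕ) : ℂ) * Complex.I) + b • y) j -
      (a • (fun k : Fin n => ((k : ℕ) : ℂ) * Complex.I) + b • y) i).im =
      a * (((j : ℕ) : ℝ) - ((i : ℕ) : ℝ)) + b * (y j - y i).im := by
    simp; ring
  have hre : ((a • (fun k : Fin n => ((k : ℕ) : ℂ) * Complex.I) + b • y) j -
      (a • (fun k : Fin n => ((k : ℕ) : ℂ) * Complex.I) + b • y) i).re =
      b * (y j - y i).re := by
    simp; ring
  rw [him, hre]
  rcases hb.eq_or_lt with rfl | hb
  · left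
    have : a = 1 := by linarith
    subst this
    linarith
  · rcases hy i j hij with h | h
    · left
      have := mul_pos hb h
      have := mul_nonneg ha (sub_nonneg.2 hij'.le)
      linarith
    · right
      exact mul_ne_zero hb.ne' h

lemma mem_starSet_of_re {n : ℕ} {y : Fin n → ℂ}
    (h : ∀ i j : Fin n, i < j → (y j - y i).re ≠ 0) : y ∈ starSet n :=
  fun i j hij => Or.inr (h i j hij)

lemma star_of_ne_zero {z : ℂ} (h0 : z ≠ 0) (h : 0 ≤ z.im) : 0 < z.im ∨ z.re ≠ 0 := by
  rcases h.eq_or_lt with h | h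
  · exact Or.inr fun h' => h0 (Complex.ext h' h.symm)
  · exact Or.inl h

instance (n : ℕ) : ContractibleSpace (starSet n) := by
  refine (starConvex_starSet n).contractibleSpace ⟨fun k => ((k : ℕ) : ℂ) * Complex.I, ?_⟩
  intro i j hij
  left
  have hij' : ((i : ℕ) : ℝ) < ((j : ℕ) : ℝ) := by exact_mod_cast hij
  simpa using hij'

/-- The inclusion of the star-shaped set. -/
def starIncl (n : ℕ) : C(starSet n, Y n) :=
  ⟨fun y => ⟨y.1, injective_of_mem_starSet y.2⟩, by fun_prop⟩

section Star

variable {n : ℕ} (ε : Braid n →* Circle)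

/-- In the star-shaped set, the phase is the quotient of the values of `g` at the end points
of the curve. -/
def IsStarPhase (g : (Fin n → ℂ) → Circle) : Prop :=
  ∀ (y y' : Y n) (γ : Path y y'), (∀ t, (γ t).1 ∈ starSet n) → g y'.1 = g y.1 * phaseY ε γ

/-- Curves in a contractible space with the same end points are homotopic. So the phase of any curve
from a fixed vertex to `y` serves as potential; the value `1` outside the star-shaped set is
arbitrary. -/
lemma exists_isStarPhase : ∃ g : (Fin n → ℂ) → Circle, IsStarPhase ε g := by
  classical
  let v : starSet n := Classical.arbitrary _
  refine ⟨fun y => if h : y ∈ starSet n then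
    phaseY ε ((PathConnectedSpace.somePath v ⟨y, h⟩).map (starIncl n).continuous) else 1, ?_⟩
  intro y y' γ hγ
  have hy : y.1 ∈ starSet n := by simpa using hγ 0
  have hy' : y'.1 ∈ starSet n := by simpa using hγ 1
  have hc : Continuous fun t => (γ t).1 := continuous_subtype_val.comp γ.continuous
  let δ : Path (⟨y.1, hy⟩ : starSet n) ⟨y'.1, hy'⟩ :=
    ⟨⟨fun t => ⟨(γ t).1, hγ t⟩, by fun_prop⟩, by simp, by simp⟩
  have hδ : phaseY ε γ = phaseY ε (δ.map (starIncl n).continuous) :=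
    phase_congr ε fun t => rfl
  simp only [dif_pos hy, dif_pos hy']
  rw [hδ, ← phaseY_trans, ← Path.map_trans]
  have := SimplyConnectedSpace.paths_homotopic
    ((PathConnectedSpace.somePath v ⟨y.1, hy⟩).trans δ) (PathConnectedSpace.somePath v ⟨y'.1, hy'⟩)
  have h2 := (this.map (starIncl n)).map ⟨_, continuous_proj n⟩
  exact congrArg (phase ε) (Path.Homotopic.Quotient.eq.2 h2).symm

end Star

/-- The curve in `Y n` that a motion of `n` particles describes. -/
def motion {n : ℕ} (f : ℝ → Fin n → ℂ) (hf : ∀ k, Continuous fun t => f t k)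
    (hinj : ∀ t, Function.Injective (f t)) : Path (⟨f 0, hinj 0⟩ : Y n) ⟨f 1, hinj 1⟩ where
  toFun t := ⟨f t, hinj t⟩
  continuous_toFun :=
    Continuous.subtype_mk (continuous_pi fun k => (hf k).comp continuous_subtype_val) _
  source' := by simp
  target' := by simp

lemma phase_braidOf {n : ℕ} (ε : Braid n →* Circle) (f : ℝ → Fin n → ℂ)
    (hf : ∀ k, Continuous fun t => f t k)
    (hinj : ∀ t, Function.Injective (f t)) (h0 : f 0 = (baseY n).1)
    (π : Equiv.Perm (Fin n)) (h1 : f 1 = (baseY n).1 ∘ π) :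
    ε (braidOf f hf hinj h0 π h1) = phaseY ε (motion f hf hinj) := by
  rw [braidOf, ← phase_fromPath]
  exact phase_congr ε fun t => rfl

/-- The numbering in which a motion is given may leave the star-shaped set while another one keeps
it inside; renumbering by `σ` does not affect the phase. -/
lemma IsStarPhase.motion {n : ℕ} {ε : Braid n →* Circle} {g : (Fin n → ℂ) → Circle}
    (hg : IsStarPhase ε g) (f : ℝ → Fin n → ℂ) (hf : ∀ k, Continuous fun t => f t k)
    (hinj : ∀ t, Function.Injective (f t)) (σ : Equiv.Perm (Fin n))
    (h : ∀ t : unitInterval, f t ∘ σ ∈ starSet n) {y₀ y₁ : Fin n → ℂ} (h₀ : f 0 ∘ σ = y₀)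
    (h₁ : f 1 ∘ σ = y₁) : g y₁ = g y₀ * phaseY ε (motion f hf hinj) := by
  subst h₀ h₁
  rw [hg _ _ (Anyon.motion (fun t => f t ∘ σ) (fun k => hf (σ k))
    fun t => (hinj t).comp σ.injective) h]
  congr 1
  exact phaseY_eq_of_perm ε _ _ σ fun t => rfl

/-! ### Inversions of permutations -/

/-- The inversions of the inverse of a permutation. -/
def invPairs {n : ℕ} (σ : Equiv.Perm (Fin n)) : Finset (Fin n × Fin n) :=
  {x | x.1 < x.2 ∧ σ⁻¹ x.2 < σ⁻¹ x.1}

lemma mem_invPairs {n : ℕ} {σ : Equiv.Perm (Fin n)} {x : Fin n × Fin n} :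
    x ∈ invPairs σ ↔ x.1 < x.2 ∧ σ⁻¹ x.2 < σ⁻¹ x.1 := by
  simp [invPairs]

/-- Adjacent transpositions preserve the order of all other pairs. -/
lemma swap_lt_swap {n i : ℕ} (hi : i + 1 < n) {p q : Fin n} (hpq : p < q)
    (hne : ¬ ((p : ℕ) = i ∧ (q : ℕ) = i + 1)) :
    Equiv.swap (⟨i, by omega⟩ : Fin n) ⟨i + 1, hi⟩ p <
      Equiv.swap (⟨i, by omega⟩ : Fin n) ⟨i + 1, hi⟩ q := by
  rw [Fin.lt_def] at hpq
  simp only [Equiv.swap_apply_def, Fin.ext_iff]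
  split_ifs <;> simp only [Fin.lt_def] <;> omega

/-- The transposition carries the inversions of `σ⁻¹` injectively to those of `(s σ)⁻¹`, and the
only new one is the pair of exchanged neighbors. -/
lemma card_invPairs_swap_mul {n i : ℕ} (hi : i + 1 < n) (σ : Equiv.Perm (Fin n))
    (h : σ⁻¹ ⟨i, by omega⟩ < σ⁻¹ ⟨i + 1, hi⟩) :
    (invPairs (Equiv.swap (⟨i, by omega⟩ : Fin n) ⟨i + 1, hi⟩ * σ)).card =
      (invPairs σ).card + 1 := by
  set a : Fin n := ⟨i, by omega⟩ with ha
  set b : Fin n := ⟨i + 1, hi⟩ with hb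
  have hab : a < b := by simp [ha, hb]
  have hsw : ∀ p q : Fin n, p < q → ¬ (p = a ∧ q = b) → Equiv.swap a b p < Equiv.swap a b q :=
    fun p q hpq hne => swap_lt_swap hi hpq fun h => hne ⟨Fin.ext h.1, Fin.ext h.2⟩
  have hmem : ∀ p q, (p, q) ∈ invPairs (Equiv.swap a b * σ) ↔
      p < q ∧ σ⁻¹ (Equiv.swap a b q) < σ⁻¹ (Equiv.swap a b p) := by
    intro p q
    simp [mem_invPairs]
  have hS : invPairs (Equiv.swap a b * σ) = insert (a, b)
      ((invPairs σ).map ((Equiv.swap a b).prodCongr (Equiv.swap a b)).toEmbedding) := by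
    ext ⟨p, q⟩
    rw [hmem, Finset.mem_insert, Finset.mem_map_equiv, mem_invPairs]
    simp only [Equiv.prodCongr_symm, Equiv.symm_swap, Equiv.prodCongr_apply, Prod.map_apply,
      Prod.mk.injEq]
    constructor
    · rintro ⟨h1, h2⟩
      by_cases hne : p = a ∧ q = b
      · exact Or.inl hne
      · exact Or.inr ⟨hsw p q h1 hne, h2⟩
    · rintro (⟨rfl, rfl⟩ | ⟨h1, h2⟩)
      · exact ⟨hab, by simpa using h⟩
      · refine ⟨?_, h2⟩
        -- By `h`, the pair `(a, b)` is not an inversion before the exchange.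
        by_cases hne : Equiv.swap a b p = a ∧ Equiv.swap a b q = b
        · rw [hne.1, hne.2] at h2
          exact absurd h2 h.asymm
        · simpa using hsw _ _ h1 hne
  rw [hS, Finset.card_insert_of_notMem, Finset.card_map]
  rw [Finset.mem_map_equiv, mem_invPairs]
  simp only [Equiv.prodCongr_symm, Equiv.symm_swap, Equiv.prodCongr_apply, Prod.map_apply,
    Equiv.swap_apply_left, Equiv.swap_apply_right]
  exact fun h' => h'.1.asymm hab

lemma eq_one_of_forall_lt {n : ℕ} (ρ : Equiv.Perm (Fin n))
    (h : ∀ (i : ℕ) (hi : i + 1 < n), ρ ⟨i, by omega⟩ < ρ ⟨i + 1, hi⟩) : ρ = 1 := by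
  rcases n with _ | m
  · exact Subsingleton.elim _ _
  · have hm : StrictMono ρ := Fin.strictMono_iff_lt_succ.2 fun i => h i (by omega)
    have := Subsingleton.elim (hm.orderIsoOfSurjective ρ ρ.surjective) (OrderIso.refl _)
    ext i
    exact congrArg Fin.val (congrArg (fun e : Fin (m + 1) ≃o Fin (m + 1) => e i) this)

/-! ### The phases of positive permutation braids -/

lemma halfTurn_re (t : ℝ) : (halfTurn t).re = (1 - Real.cos (Real.pi * t)) / 2 := by
  rw [halfTurn, ← Complex.ofReal_mul, show (2 : ℂ) = ((2 : ℝ) : ℂ) by norm_num,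
    Complex.div_ofReal_re, Complex.sub_re, Complex.exp_ofReal_mul_I_re, Complex.one_re]

lemma one_sub_two_mul_halfTurn (t : ℝ) :
    1 - 2 * halfTurn t = Complex.exp ((Real.pi * t : ℝ) * Complex.I) := by
  rw [halfTurn]
  push_cast
  ring

lemma sin_pi_mul_nonneg (t : unitInterval) : 0 ≤ Real.sin (Real.pi * t) :=
  Real.sin_nonneg_of_nonneg_of_le_pi (mul_nonneg Real.pi_pos.le t.2.1)
    (mul_le_of_le_one_right Real.pi_pos.le t.2.2)

/-- The exchanged particles move in the strip between `i` and `i + 1` and reach its edges only at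
integer positions, so their real parts never meet those of the resting particles. -/
lemma exchangeY_sub_re_ne_zero {n i : ℕ} (t : ℝ) {p q : Fin n} (hpq : p ≠ q)
    (h1 : ¬ ((p : ℕ) = i ∧ (q : ℕ) = i + 1)) (h2 : ¬ ((q : ℕ) = i ∧ (p : ℕ) = i + 1)) :
    (exchangeY n i t q - exchangeY n i t p).re ≠ 0 := by
  have hc0 : 0 ≤ (halfTurn t).re := by
    rw [halfTurn_re]; linarith [Real.cos_le_one (Real.pi * t)]
  have hc1 : (halfTurn t).re ≤ 1 := by
    rw [halfTurn_re]; linarith [Real.neg_one_le_cos (Real.pi * t)]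
  have hne : (p : ℕ) ≠ (q : ℕ) := fun h => hpq (Fin.ext h)
  rw [Complex.sub_re, sub_ne_zero]
  unfold exchangeY
  have hlt : ∀ a b : ℕ, a < b → (a : ℝ) + 1 ≤ b := fun a b h => by exact_mod_cast h
  split_ifs <;> simp only [Complex.add_re, Complex.sub_re, Complex.natCast_re]
  all_goals first
    | omega
    | intro heq
      rcases lt_or_gt_of_ne hne with h | h <;>
      first
      | linarith [hlt _ _ h]
      | have := hlt ((p : ℕ) + 1) q (by omega)
        push_cast at this
        linarith
      | have := hlt ((q : ℕ) + 1) p (by omega)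
        push_cast at this
        linarith

/-- The exchanged particles differ by `e^{iπt}`, which runs through the closed upper half-plane; the
hypothesis says that this is the difference of the higher-numbered minus the lower-numbered one. All
other pairs keep distinct real parts. -/
lemma exchangeY_comp_mem_starSet {n i : ℕ} (hi : i + 1 < n) (σ : Equiv.Perm (Fin n))
    (h : σ⁻¹ ⟨i, by omega⟩ < σ⁻¹ ⟨i + 1, hi⟩) (t : unitInterval) :
    exchangeY n i t ∘ σ ∈ starSet n := by
  intro j k hjk
  by_cases h1 : (σ j : ℕ) = i ∧ (σ k : ℕ) = i + 1
  · have : exchangeY n i t (σ k) - exchangeY n i t (σ j) =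
        Complex.exp ((Real.pi * t : ℝ) * Complex.I) := by
      simp only [exchangeY, h1, if_true, if_false, Nat.succ_ne_self, ← one_sub_two_mul_halfTurn]
      push_cast
      ring
    rw [Function.comp, Function.comp, this]
    refine star_of_ne_zero (Complex.exp_ne_zero _) ?_
    rw [Complex.exp_ofReal_mul_I_im]
    exact sin_pi_mul_nonneg t
  · right
    refine exchangeY_sub_re_ne_zero t (fun h => hjk.ne (σ.injective h)) h1 fun h2 => ?_
    have hk : σ k = ⟨i, by omega⟩ := Fin.ext h2.1
    have hj : σ j = ⟨i + 1, hi⟩ := Fin.ext h2.2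
    rw [← hk, ← hj] at h
    simp at h
    exact h.asymm hjk

section

variable {n : ℕ} {ε : Braid n →* Circle} {g : (Fin n → ℂ) → Circle}

lemma IsStarPhase.swap_mul (hg : IsStarPhase ε g) {i : ℕ} (hi : i + 1 < n)
    (σ : Equiv.Perm (Fin n)) (h : σ⁻¹ ⟨i, by omega⟩ < σ⁻¹ ⟨i + 1, hi⟩) :
    g ((baseY n).1 ∘ (Equiv.swap (⟨i, by omega⟩ : Fin n) ⟨i + 1, hi⟩ * σ : Equiv.Perm (Fin n))) =
      g ((baseY n).1 ∘ σ) * ε (exchange n i hi) := by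
  rw [exchange, phase_braidOf]
  have h0 : exchangeY n i 0 = (baseY n).1 := by
    ext k; simp [exchangeY, halfTurn_zero, baseY]
  have h1 : exchangeY n i 1 = (baseY n).1 ∘ Equiv.swap (⟨i, by omega⟩ : Fin n) ⟨i + 1, hi⟩ := by
    ext k
    simp only [exchangeY, halfTurn_one, baseY, Function.comp, Equiv.swap_apply_def, Fin.ext_iff]
    split_ifs <;> simp_all
  exact hg.motion (exchangeY n i) _ exchangeY_injective σ (exchangeY_comp_mem_starSet hi σ h)
    (by rw [h0]) (by rw [h1]; rfl)

/-- All elementary exchanges have the same phase. -/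
lemma exchange_phase_succ {i : ℕ} (hi : i + 2 < n) :
    ε (exchange n (i + 1) hi) = ε (exchange n i (by omega)) := by
  obtain ⟨g, hg⟩ := exists_isStarPhase ε
  set a : Fin n := ⟨i, by omega⟩ with ha
  set b : Fin n := ⟨i + 1, by omega⟩ with hb
  set c : Fin n := ⟨i + 2, hi⟩ with hc
  have hab : a < b := by simp [ha, hb]
  have hbc : b < c := by simp [hb, hc]
  have hac : a < c := hab.trans hbc
  have hs : ∀ σ : Equiv.Perm (Fin n), σ⁻¹ a < σ⁻¹ b →
      g ((baseY n).1 ∘ (Equiv.swap a b * σ : Equiv.Perm (Fin n))) =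
        g ((baseY n).1 ∘ σ) * ε (exchange n i (by omega)) := fun σ h => hg.swap_mul _ σ h
  have hs' : ∀ σ : Equiv.Perm (Fin n), σ⁻¹ b < σ⁻¹ c →
      g ((baseY n).1 ∘ (Equiv.swap b c * σ : Equiv.Perm (Fin n))) =
        g ((baseY n).1 ∘ σ) * ε (exchange n (i + 1) hi) := fun σ h => hg.swap_mul _ σ h
  have sa : Equiv.swap b c a = a := Equiv.swap_apply_of_ne_of_ne hab.ne hac.ne
  have sc : Equiv.swap a b c = c := Equiv.swap_apply_of_ne_of_ne hac.ne' hbc.ne'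
  -- The reversal of three neighbors is reached by two words of length three, `aba` and `bab`; each
  -- letter adds an inversion, so each exchange stays in the star-shaped set. Comparing the values
  -- of `g` gives the braid relation for phases, and commutativity leaves equality of the two
  -- letters.
  have h3 := hs (Equiv.swap b c * (Equiv.swap a b * 1)) (by simpa [sa, sc] using hbc)
  rw [hs' (Equiv.swap a b * 1) (by simpa [sc] using hac), hs 1 hab] at h3
  have h3' := hs' (Equiv.swap a b * (Equiv.swap b c * 1)) (by simpa [sa, sc] using hab)
  rw [hs (Equiv.swap b c * 1) (by simpa [sa] using hac), hs' 1 hbc] at h3'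
  have hbraid : Equiv.swap a b * (Equiv.swap b c * (Equiv.swap a b * 1)) =
      Equiv.swap b c * (Equiv.swap a b * (Equiv.swap b c * 1)) := by
    have e1 := Equiv.swap_mul_swap_mul_swap hab.ne hac.ne
    have e2 := Equiv.swap_mul_swap_mul_swap hbc.ne' hac.ne'
    rw [Equiv.swap_comm c b, Equiv.swap_comm b a, ← Equiv.swap_comm c a] at e2
    rw [mul_one, mul_one, ← mul_assoc, ← mul_assoc, e1, e2]
  rw [hbraid, h3'] at h3
  simp only [mul_assoc] at h3
  have h4 := mul_left_cancel h3
  rw [mul_left_comm] at h4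
  exact mul_left_cancel (mul_left_cancel h4)

/-- The phase of a positive permutation braid is determined by the number of inversions. -/
lemma IsStarPhase.perm (hg : IsStarPhase ε g) {κ : Circle} (hε : HasStatisticsPhase ε κ)
    (σ : Equiv.Perm (Fin n)) :
    g ((baseY n).1 ∘ σ) = κ ^ (invPairs σ).card * g (baseY n).1 := by
  have hκ : ∀ (i : ℕ) (hi : i + 1 < n), ε (exchange n i hi) = κ := by
    intro i
    induction i with
    | zero => exact hε
    | succ i ih => exact fun hi => (exchange_phase_succ hi).trans (ih _)
  induction hN : (invPairs σ).card generalizing σ with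
  | zero =>
    have hσ : σ⁻¹ = 1 := by
      refine eq_one_of_forall_lt _ fun i hi => ?_
      by_contra h
      have hm : ((⟨i, by omega⟩, ⟨i + 1, hi⟩) : Fin n × Fin n) ∈ invPairs σ := by
        refine mem_invPairs.2 ⟨by simp, lt_of_le_of_ne (not_lt.1 h) fun h' => ?_⟩
        simpa using σ⁻¹.injective h'
      rw [Finset.card_eq_zero] at hN
      simp [hN] at hm
    rw [inv_eq_one.1 hσ]
    simp
  | succ N ih =>
    -- A permutation with an inversion has a descent between neighbors, since otherwise its inverse
    -- would be increasing, hence the identity. Undoing this descent lowers the number of inversions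
    -- by one.
    have hex : ∃ (i : ℕ) (hi : i + 1 < n), σ⁻¹ ⟨i + 1, hi⟩ < σ⁻¹ ⟨i, by omega⟩ := by
      by_contra! hcon
      have hσ : σ⁻¹ = 1 := eq_one_of_forall_lt _ fun i hi =>
        lt_of_le_of_ne (hcon i hi) fun h' => by simpa using σ⁻¹.injective h'
      have : invPairs σ = ∅ := by
        ext x
        rw [mem_invPairs, hσ]
        simpa using fun h => le_of_lt h
      simp [this] at hN
    obtain ⟨i, hi, h⟩ := hex
    set s := Equiv.swap (⟨i, by omega⟩ : Fin n) ⟨i + 1, hi⟩ with hs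
    have h' : (s * σ)⁻¹ ⟨i, by omega⟩ < (s * σ)⁻¹ ⟨i + 1, hi⟩ := by
      simpa [hs] using h
    have hσ : σ = s * (s * σ) := by simp [hs, ← mul_assoc]
    have hcard := card_invPairs_swap_mul hi (s * σ) h'
    rw [← hs, ← hσ] at hcard
    have hstep := hg.swap_mul hi (s * σ) h'
    rw [← hs, ← hσ, hκ, ih (s * σ) (by omega)] at hstep
    rw [hstep, pow_succ]
    exact mul_right_comm _ _ _

end

/-! ### The phase of the exchange of two clusters -/

/-- The order is preserved within each cluster and reversed between the clusters. -/
lemma card_invPairs_clusterSwap (n : ℕ) :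
    (invPairs ((clusterSwap_involutive n).toPerm (clusterSwap n))).card = n * n := by
  have h1 : invPairs ((clusterSwap_involutive n).toPerm (clusterSwap n)) =
      (Finset.univ.filter fun p : Fin (2 * n) => (p : ℕ) < n) ×ˢ
        (Finset.univ.filter fun p : Fin (2 * n) => (p : ℕ) < n)ᶜ := by
    ext ⟨p, q⟩
    have := p.2
    have := q.2
    simp only [mem_invPairs, Finset.mem_product, Finset.mem_compl, Finset.mem_filter,
      Finset.mem_univ, true_and, Equiv.Perm.inv_def, Function.Involutive.toPerm_symm,
      Function.Involutive.coe_toPerm, clusterSwap]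
    split_ifs <;> simp only [Fin.lt_def] <;> omega
  have h2 : (Finset.univ.filter fun p : Fin (2 * n) => (p : ℕ) < n).card = n := by
    rw [Fin.card_filter_val_lt]
    omega
  rw [h1, Finset.card_product, Finset.card_compl, h2, Fintype.card_fin, two_mul,
    Nat.add_sub_cancel]

/-- Within a cluster the differences are constant; across, the second cluster minus the first has
imaginary part `n sin(πt) ≥ 0`. -/
lemma clusterY_mem_starSet {n : ℕ} (t : unitInterval) : clusterY n t ∈ starSet (2 * n) := by
  intro j k hjk
  refine star_of_ne_zero (sub_ne_zero.2 fun h => hjk.ne' (clusterY_injective t h)) ?_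
  have him : (halfTurn t).im = - Real.sin (Real.pi * t) / 2 := by
    rw [halfTurn, ← Complex.ofReal_mul, show (2 : ℂ) = ((2 : ℝ) : ℂ) by norm_num,
      Complex.div_ofReal_im, Complex.sub_im, Complex.exp_ofReal_mul_I_im, Complex.one_im, zero_sub]
  have := mul_nonneg (Nat.cast_nonneg (α := ℝ) n) (sin_pi_mul_nonneg t)
  rw [Fin.lt_def] at hjk
  unfold clusterY
  split_ifs
  all_goals first
    | omega
    | simp [him]
  linarith

lemma clusterPhase_eq {n : ℕ} {ε : Braid (2 * n) →* Circle} {κ : Circle}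
    (hε : HasStatisticsPhase ε κ) : clusterPhase ε = κ ^ (n * n) := by
  obtain ⟨g, hg⟩ := exists_isStarPhase ε
  have h := hg.perm hε ((clusterSwap_involutive n).toPerm (clusterSwap n))
  have h0 : clusterY n 0 = (baseY (2 * n)).1 := by
    ext k; simp [clusterY, halfTurn_zero, baseY]
  have h1 : clusterY n 1 =
      (baseY (2 * n)).1 ∘ (clusterSwap_involutive n).toPerm (clusterSwap n) := by
    ext k
    have h2 : ((clusterSwap n k : ℕ) : ℂ) =
        if (k : ℕ) < n then ((k : ℕ) : ℂ) + n else ((k : ℕ) : ℂ) - n := by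
      unfold clusterSwap
      split_ifs with h
      · simp
      · exact Nat.cast_sub (not_lt.1 h)
    simp only [clusterY, halfTurn_one, baseY, Function.comp, mul_one]
    exact h2.symm
  have hm := hg.motion (clusterY n) (fun k => by
      have := continuous_halfTurn
      unfold clusterY
      split_ifs <;> fun_prop) clusterY_injective 1 clusterY_mem_starSet h0 h1
  rw [hm, card_invPairs_clusterSwap, mul_comm] at h
  rw [clusterPhase, clusterExchange, phase_braidOf]
  exact mul_right_cancel h

/-! ### The phase of the full rotation -/

lemma two_mul_card_invPairs_rev (n : ℕ) :
    2 * (invPairs (Fin.revPerm : Equiv.Perm (Fin n))).card = n * (n - 1) := by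
  have h : (invPairs (Fin.revPerm : Equiv.Perm (Fin n))).card = ∑ i ∈ Finset.range n, i := by
    have h1 : invPairs (Fin.revPerm : Equiv.Perm (Fin n)) =
        Finset.univ.filter fun x : Fin n × Fin n => x.1 < x.2 := by
      ext x
      rw [mem_invPairs]
      simp [Equiv.Perm.inv_def]
    rw [h1, Finset.card_filter, Fintype.sum_prod_type_right, ← Fin.sum_univ_eq_sum_range fun i => i]
    refine Finset.sum_congr rfl fun q _ => ?_
    rw [← Finset.card_filter]
    simp [Finset.filter_gt_eq_Iio]
  rw [h, mul_comm, Finset.sum_range_id_mul_two]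

lemma exp_smul_mem_starSet {n : ℕ} (t : unitInterval) {y : Fin n → ℂ}
    (h : ∀ i j : Fin n, y j - y i =
      Complex.exp ((Real.pi * t : ℝ) * Complex.I) * (((j : ℕ) : ℂ) - ((i : ℕ) : ℂ))) :
    y ∈ starSet n := by
  intro i j hij
  have hij' : (0 : ℝ) < ((j : ℕ) : ℝ) - ((i : ℕ) : ℝ) := sub_pos.2 (by exact_mod_cast hij)
  have hc : ((j : ℕ) : ℂ) - ((i : ℕ) : ℂ) = ((((j : ℕ) : ℝ) - ((i : ℕ) : ℝ) : ℝ) : ℂ) := by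
    push_cast; rfl
  rw [h, hc]
  refine star_of_ne_zero (mul_ne_zero (Complex.exp_ne_zero _)
    (Complex.ofReal_ne_zero.2 hij'.ne')) ?_
  rw [Complex.im_mul_ofReal, Complex.exp_ofReal_mul_I_im]
  exact mul_nonneg (sin_pi_mul_nonneg t) hij'.le

/-- The full counterclockwise rotation of the base configuration has phase `κ ^ (n (n - 1))`. -/
lemma phase_rotPath_two_pi {n : ℕ} {ε : Braid n →* Circle} {κ : Circle}
    (hε : HasStatisticsPhase ε κ) :
    phase ε (.mk (rotPath (2 * Real.pi) (base n))) = κ ^ (n * (n - 1)) := by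
  obtain ⟨g, hg⟩ := exists_isStarPhase ε
  -- The two half turns, `a = 0` and `a = 1`. They rotate about particle `0`, not about the center
  -- of the row, so a half turn produces a translate of the reversed row; the translation `τ` by
  -- `-(n - 1)` corrects this.
  let ρ : ℝ → ℝ → Fin n → ℂ := fun a t k =>
    Complex.exp ((Real.pi * (t + a) : ℝ) * Complex.I) * ((k : ℕ) : ℂ)
  let τ : ℝ → Fin n → ℂ := fun t k => ((k : ℕ) : ℂ) - t * ((n : ℂ) - 1)
  have hρc : ∀ a k, Continuous fun t => ρ a t k := by intro a k; fun_prop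
  have hτc : ∀ k, Continuous fun t => τ t k := by intro k; fun_prop
  have hbase : ∀ i j : Fin n, ((i : ℕ) : ℂ) = ((j : ℕ) : ℂ) → i = j := fun i j h =>
    (baseY n).2 h
  have hρi : ∀ a t, Function.Injective (ρ a t) := fun a t i j h =>
    hbase i j (mul_left_cancel₀ (Complex.exp_ne_zero _) h)
  have hτi : ∀ t, Function.Injective (τ t) := fun t i j h => hbase i j (sub_left_injective h)
  have hrev : ∀ k : Fin n, ((Fin.rev k : ℕ) : ℂ) = (n : ℂ) - 1 - ((k : ℕ) : ℂ) := by
    intro k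
    have : ((Fin.rev k : ℕ) : ℂ) + ((k : ℕ) + 1 : ℕ) = (n : ℂ) := by
      rw [← Nat.cast_add]
      congr 1
      have := k.2
      rw [Fin.val_rev]
      omega
    push_cast at this
    linear_combination this
  have hexp : ∀ t : ℝ, Complex.exp ((Real.pi * (t + 1) : ℝ) * Complex.I) =
      - Complex.exp ((Real.pi * t : ℝ) * Complex.I) := by
    intro t
    push_cast
    rw [mul_add, add_mul, Complex.exp_add, mul_one, Complex.exp_pi_mul_I, mul_neg_one]
  have h1 := hg.motion (ρ 0) (hρc 0) (hρi 0) 1 (y₀ := (baseY n).1)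
    (y₁ := fun k => - ((k : ℕ) : ℂ)) (fun t => exp_smul_mem_starSet t fun i j => by
      simp [ρ, mul_sub]) (by ext k; simp [ρ, baseY])
    (by ext k; simp [ρ, Complex.exp_pi_mul_I])
  -- Reversing the numbering makes the row increasing again, so the second half turn also stays in
  -- the star-shaped set.
  have h2 := hg.motion (ρ 1) (hρc 1) (hρi 1) Fin.revPerm (y₀ := fun k => ((k : ℕ) : ℂ) - (n - 1))
    (y₁ := (baseY n).1 ∘ (Fin.revPerm : Equiv.Perm (Fin n)))
    (fun t => exp_smul_mem_starSet t fun i j => by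
      simp only [ρ, Function.comp, Fin.revPerm_apply, hrev, hexp]
      ring)
    (by
      ext k
      simp only [ρ, Function.comp, Fin.revPerm_apply, hrev, hexp]
      simp)
    (by
      ext k
      simp only [ρ, Function.comp, Fin.revPerm_apply, hrev, hexp, baseY]
      simp [Complex.exp_pi_mul_I])
  have hτs : ∀ (t : ℝ) (σ : Equiv.Perm (Fin n)), τ t ∘ σ ∈ starSet n := by
    intro t σ
    refine mem_starSet_of_re fun i j hij h => hij.ne' (σ.injective (hbase _ _ ?_))
    simpa [τ, sub_eq_zero] using h
  -- The same translation, read in both numberings: its phase `e` enters the two half turns with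
  -- opposite signs and cancels.
  have h3 := hg.motion τ hτc hτi 1 (y₀ := (baseY n).1) (y₁ := fun k => ((k : ℕ) : ℂ) - (n - 1))
    (fun t => hτs t 1) (by ext k; simp [τ, baseY]) (by ext k; simp [τ])
  have h4 := hg.motion τ hτc hτi Fin.revPerm
    (y₀ := (baseY n).1 ∘ (Fin.revPerm : Equiv.Perm (Fin n))) (y₁ := fun k => - ((k : ℕ) : ℂ))
    (fun t => hτs t _) (by ext k; simp [τ, baseY])
    (by
      ext k
      simp only [τ, Function.comp, Fin.revPerm_apply, hrev]
      push_cast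
      ring)
  have hp := hg.perm hε Fin.revPerm
  have hstart : (⟨ρ 0 1, hρi 0 1⟩ : Y n) = ⟨ρ 1 0, hρi 1 0⟩ := Subtype.ext (by simp [ρ])
  have htotal : phase ε (.mk (rotPath (2 * Real.pi) (base n))) =
      phaseY ε ((motion (ρ 0) (hρc 0) (hρi 0)).trans
        ((motion (ρ 1) (hρc 1) (hρi 1)).cast hstart rfl)) := by
    refine phase_congr ε fun t => congrArg (proj n) ?_
    rw [Path.trans_apply]
    split_ifs
    · refine Subtype.ext (funext fun k => ?_)
      simp only [rotY, motion, Path.coe_mk', ContinuousMap.coe_mk, ρ, baseY]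
      congr 2
      push_cast
      ring
    · refine Subtype.ext (funext fun k => ?_)
      simp only [rotY, motion, Path.cast_coe, Path.coe_mk', ContinuousMap.coe_mk, ρ, baseY]
      congr 2
      push_cast
      ring
  have hcast : phaseY ε ((motion (ρ 1) (hρc 1) (hρi 1)).cast hstart rfl) =
      phaseY ε (motion (ρ 1) (hρc 1) (hρi 1)) := phase_congr ε fun t => rfl
  rw [htotal, phaseY_trans, hcast, ← two_mul_card_invPairs_rev, two_mul, pow_add]
  rw [hp] at h2 h4
  rw [h3] at h2
  rw [h4] at h1
  generalize phaseY ε (motion (ρ 0) (hρc 0) (hρi 0)) = e1 at *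
  generalize phaseY ε (motion (ρ 1) (hρc 1) (hρi 1)) = e2 at *
  generalize phaseY ε (motion τ hτc hτi) = e at *
  generalize κ ^ _ = c at *
  generalize g (baseY n).1 = b at *
  -- With `c = κ^(n(n-1)/2)`, the half turns have phases `e1 = c e` and `e2 = c e⁻¹`, so `e1 * e2 =
  -- c * c`.
  have h1' : c * e = e1 := by
    apply mul_left_cancel (a := b); rw [← h1]; exact (mul_left_comm b c e).trans (mul_assoc c b e).symm
  have h2' : c = e * e2 := by
    apply mul_left_cancel (a := b); rw [mul_comm b c, h2, mul_assoc]
  rw [← h1', mul_assoc, ← h2']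

/-! ### The full rotation of wave functions -/

lemma rotY_eq_of_exp_eq {n : ℕ} {α β : ℝ}
    (h : Complex.exp (α * Complex.I) = Complex.exp (β * Complex.I)) (y : Y n) :
    rotY α y = rotY β y :=
  Subtype.ext (funext fun k => by simp only [rotY, h])

lemma rot_eq_of_exp_eq {n : ℕ} {α β : ℝ}
    (h : Complex.exp (α * Complex.I) = Complex.exp (β * Complex.I)) (p : X n) :
    rot α p = rot β p := by
  induction p using Quotient.inductionOn with
  | h y => exact congrArg (proj n) (rotY_eq_of_exp_eq h y)

lemma rot_neg_two_pi {n : ℕ} (p : X n) : rot (-(2 * Real.pi)) p = p := by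
  rw [rot_eq_of_exp_eq (β := 0) _ p, rot_zero]
  push_cast
  rw [neg_mul, Complex.exp_neg, Complex.exp_two_pi_mul_I]
  simp

/-- The class of the full clockwise rotation of the base configuration. -/
def clockwise (n : ℕ) : Braid n :=
  FundamentalGroup.fromPath
    (.mk ((rotPath (-(2 * Real.pi)) (base n)).cast rfl (rot_neg_two_pi _).symm))

/-- A curve followed by the rotation of its end point is homotopic to the rotation of its starting
point followed by the rotated curve. For a full turn the rotated curve is the original one, so the
rotation becomes a loop at the base point. -/
lemma Cover.rot_neg_two_pi {n : ℕ} (x : Cover n) :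
    Cover.rot (-(2 * Real.pi)) x = x.act (clockwise n) := by
  obtain ⟨p, ξ⟩ := x
  obtain ⟨γ, rfl⟩ := Path.Homotopic.Quotient.mk_surjective ξ
  have h : Cover.rot (-(2 * Real.pi)) (⟨p, .mk γ⟩ : Cover n) =
      ⟨Anyon.rot (-(2 * Real.pi)) p,
        .mk ((rotPath (-(2 * Real.pi)) (base n)).trans (γ.map (Anyon.continuous_rot _)))⟩ :=
    congrArg (Sigma.mk _) (Path.Homotopic.Quotient.eq.2 (square_homotopic _ γ))
  rw [h]
  refine Sigma.ext (Anyon.rot_neg_two_pi p) (Path.Homotopic.hpath_hext (fun t => ?_))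
  rw [Path.trans_apply, Path.trans_apply]
  split_ifs
  · rfl
  · exact Anyon.rot_neg_two_pi _

lemma phase_clockwise_inv {n : ℕ} (ε : Braid n →* Circle) :
    ε (clockwise n)⁻¹ = phase ε (.mk (rotPath (2 * Real.pi) (base n))) := by
  rw [clockwise, FundamentalGroup.inv_def, ← Path.Homotopic.Quotient.mk_symm]
  refine (phase_fromPath ε _).symm.trans (phase_congr ε fun t => ?_)
  change rot ((unitInterval.symm t : ℝ) * -(2 * Real.pi)) (base n) =
    rot ((t : ℝ) * (2 * Real.pi)) (base n)
  -- The reversed clockwise turn is at angle `2πt - 2π` at time `t`, which is the counterclockwise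
  -- one modulo `2π`.
  refine rot_eq_of_exp_eq ?_ _
  rw [unitInterval.coe_symm_eq]
  have : (((1 - (t : ℝ)) * -(2 * Real.pi) : ℝ) : ℂ) * Complex.I =
      (((t : ℝ) * (2 * Real.pi) : ℝ) : ℂ) * Complex.I - 2 * Real.pi * Complex.I := by
    push_cast
    ring
  rw [this, Complex.exp_sub, Complex.exp_two_pi_mul_I, div_one]

lemma D_two_pi {n : ℕ} (ε : Braid n →* Circle) (s : ℝ) :
    D ε s (2 * Real.pi) =
      (Complex.exp (2 * Real.pi * Complex.I * s) *
        (phase ε (.mk (rotPath (2 * Real.pi) (base n))) : Circle) : ℂ) •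
        (LinearMap.id : L2 ε →ₗ[ℂ] L2 ε) := by
  refine LinearMap.ext fun φ => ?_
  obtain ⟨Ψ, rfl⟩ := Submodule.Quotient.mk_surjective _ φ
  rw [LinearMap.smul_apply, LinearMap.id_apply, ← Submodule.Quotient.mk_smul]
  refine congrArg (Submodule.Quotient.mk (p := nullFun ε)) ?_
  refine Subtype.ext (funext fun x => ?_)
  have h := Ψ.2.2.1 (clockwise n)⁻¹ x
  rw [inv_inv, ← Cover.rot_neg_two_pi, phase_clockwise_inv] at h
  change Complex.exp (Complex.I * s * (2 * Real.pi : ℝ)) * Ψ.1 (Cover.rot (-(2 * Real.pi)) x) =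
    _ * Ψ.1 x
  rw [h, ← mul_assoc]
  congr 3
  push_cast
  ring

/-! ### A wave function that does not vanish almost everywhere -/

instance (n : ℕ) : Nonempty (Y n) := ⟨baseY n⟩

/-- A neighborhood of the base configuration of distinguishable particles. -/
def nbhd (n : ℕ) : Set (Y n) := Subtype.val ⁻¹' Metric.ball (baseY n).1 (1 / 3)

lemma mem_nbhd {n : ℕ} {y : Y n} : y ∈ nbhd n ↔ ∀ k, dist (y.1 k) ((k : ℕ) : ℂ) < 1 / 3 := by
  rw [nbhd, Set.mem_preimage, Metric.mem_ball, dist_pi_lt_iff (by norm_num)]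
  rfl

lemma baseY_mem_nbhd (n : ℕ) : baseY n ∈ nbhd n :=
  Metric.mem_ball_self (by norm_num)

lemma isOpen_nbhd (n : ℕ) : IsOpen (nbhd n) := Metric.isOpen_ball.preimage continuous_subtype_val

/-- The radius `1/3` is less than half the distance of neighboring particles, so the position of a
particle determines its number. -/
lemma injOn_proj_nbhd (n : ℕ) : Set.InjOn (proj n) (nbhd n) := by
  intro y hy z hz h
  obtain ⟨π, rfl⟩ := Quotient.exact (s := permSetoid n) h
  rw [mem_nbhd] at hy hz
  have hπ : ∀ k, π k = k := by
    intro k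
    by_contra hne
    have h1 := hy (π k)
    have h2 : dist (y.1 (π k)) ((k : ℕ) : ℂ) < 1 / 3 := hz k
    have h3 := dist_triangle_left (((π k : Fin n) : ℕ) : ℂ) ((k : ℕ) : ℂ) (y.1 (π k))
    have h4 : (1 : ℝ) ≤ dist (((π k : Fin n) : ℕ) : ℂ) ((k : ℕ) : ℂ) := by
      have h5 : (1 : ℤ) ≤ |((π k : Fin n) : ℤ) - (k : ℤ)| := by
        have : ((π k : Fin n) : ℕ) ≠ k := fun h => hne (Fin.ext h)
        exact Int.one_le_abs (by omega)
      have h6 : dist (((π k : Fin n) : ℕ) : ℂ) ((k : ℕ) : ℂ) =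
          ((|((π k : Fin n) : ℤ) - (k : ℤ)| : ℤ) : ℝ) := by
        rw [Complex.dist_eq, Int.cast_abs, ← Complex.norm_intCast]
        push_cast
        rfl
      rw [h6]
      exact_mod_cast h5
    linarith
  exact Subtype.ext (funext fun k => by simp [Y.perm, hπ])

lemma nbhd_subset_starSet {n : ℕ} {y : Y n} (hy : y ∈ nbhd n) : y.1 ∈ starSet n := by
  rw [mem_nbhd] at hy
  refine mem_starSet_of_re fun i j hij => ne_of_gt ?_
  have hij' : ((i : ℕ) : ℝ) + 1 ≤ ((j : ℕ) : ℝ) := by exact_mod_cast hij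
  have hre : ∀ k : Fin n, |(y.1 k).re - ((k : ℕ) : ℝ)| < 1 / 3 := fun k => by
    have := (Complex.abs_re_le_norm _).trans_lt ((dist_eq_norm _ _).symm.trans_lt (hy k))
    simpa using this
  have hi := abs_lt.1 (hre i)
  have hj := abs_lt.1 (hre j)
  rw [Complex.sub_re]
  linarith

/-- The neighborhood of the base configuration of indistinguishable particles. -/
def projNbhd (n : ℕ) : Set (X n) := proj n '' nbhd n

lemma isOpen_projNbhd (n : ℕ) : IsOpen (projNbhd n) :=
  (isOpenQuotientMap_proj n).isOpenMap _ (isOpen_nbhd n)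

/-- The numbering of the particles by which a configuration is close to the base configuration. -/
def numbering {n : ℕ} : X n → Y n := Function.invFunOn (proj n) (nbhd n)

lemma numbering_mem {n : ℕ} {p : X n} (hp : p ∈ projNbhd n) : numbering p ∈ nbhd n :=
  Function.invFunOn_mem hp

lemma proj_numbering {n : ℕ} {p : X n} (hp : p ∈ projNbhd n) : proj n (numbering p) = p :=
  Function.invFunOn_eq hp

/-- The numbering inverts the restriction of the orbit map to `nbhd n`, which is an open embedding.
-/
lemma continuousOn_numbering (n : ℕ) : ContinuousOn numbering (projNbhd n) := by
  have he : Topology.IsOpenEmbedding fun w : nbhd n => proj n w.1 :=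
    .of_continuous_injective_isOpenMap ((continuous_proj n).comp continuous_subtype_val)
      (fun w w' h => Subtype.ext (injOn_proj_nbhd n w.2 w'.2 h))
      ((isOpenQuotientMap_proj n).isOpenMap.comp (isOpen_nbhd n).isOpenMap_subtype_val)
  rw [continuousOn_iff_continuous_domRestrict]
  have hc : Continuous fun p : projNbhd n => (⟨numbering p.1, numbering_mem p.2⟩ : nbhd n) := by
    rw [he.isInducing.continuous_iff]
    exact continuous_subtype_val.congr fun p => (proj_numbering p.2).symm
  exact continuous_subtype_val.comp hc

/-- This provides a point of the covering space over each `p` near the base point. -/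
lemma joined_base {n : ℕ} {p : X n} (hp : p ∈ projNbhd n) : Joined (base n) p := by
  have h := (PathConnectedSpace.joined (⟨(baseY n).1, nbhd_subset_starSet (baseY_mem_nbhd n)⟩ :
    starSet n) ⟨(numbering p).1, nbhd_subset_starSet (numbering_mem hp)⟩).map
      ((continuous_proj n).comp (starIncl n).continuous)
  have h' : Joined (proj n (baseY n)) (proj n (numbering p)) := h
  rwa [proj_numbering hp] at h'

section

variable {n : ℕ} {ε : Braid n →* Circle} {g : (Fin n → ℂ) → Circle}

lemma IsStarPhase.numbering (hg : IsStarPhase ε g) {p q : X n} (γ : Path p q)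
    (hγ : ∀ t, γ t ∈ projNbhd n) :
    g (numbering q).1 = g (numbering p).1 * phase ε (.mk γ) := by
  have hc : Continuous fun t => Anyon.numbering (γ t) :=
    (continuousOn_numbering n).comp_continuous γ.continuous hγ
  let δ : Path (Anyon.numbering p) (Anyon.numbering q) :=
    ⟨⟨fun t => Anyon.numbering (γ t), hc⟩, by simp, by simp⟩
  rw [hg _ _ δ fun t => nbhd_subset_starSet (numbering_mem (hγ t))]
  congr 1
  exact phase_congr ε fun t => proj_numbering (hγ t)

open Classical in
/-- An equivariant function that is locally constant over a neighborhood of the base point and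
vanishes elsewhere. -/
def localFun (ε : Braid n →* Circle) (g : (Fin n → ℂ) → Circle) (x : Cover n) : ℂ :=
  if x.proj ∈ projNbhd n then ((g (numbering x.proj).1 * (phase ε x.2)⁻¹ : Circle) : ℂ) else 0

/-- Along a curve in the neighborhood, `g` and the phase acquire the same factor, which cancels in
the quotient. So the function is constant on sheets, and its preimages are open there. -/
lemma localFun_extend (hg : IsStarPhase ε g) (x : Cover n) {q : X n} (γ : Path x.proj q)
    (hγ : ∀ t, γ t ∈ projNbhd n) : localFun ε g (x.extend γ) = localFun ε g x := by
  have h0 : x.proj ∈ projNbhd n := by simpa using hγ 0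
  have h1 : (x.extend γ).proj ∈ projNbhd n := by
    have := hγ 1
    rwa [γ.target] at this
  rw [localFun, localFun, if_pos h0, if_pos h1]
  congr 1
  change g (numbering q).1 * (phase ε (x.2.trans (.mk γ)))⁻¹ = _
  rw [hg.numbering γ hγ, phase_trans, mul_inv_rev, mul_assoc]
  exact congrArg _ (mul_inv_cancel_left _ _)

lemma isOpen_localFun (hg : IsStarPhase ε g) (S : Set ℂ) :
    IsOpen {x : Cover n | x.proj ∈ projNbhd n ∧ localFun ε g x ∈ S} := by
  rw [isOpen_iff_forall_mem_open]
  rintro x ⟨hx, hS⟩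
  refine ⟨x.sheet (projNbhd n), ?_, x.isOpen_sheet (isOpen_projNbhd n), x.mem_sheet hx⟩
  rintro _ ⟨q, γ, hγ, rfl⟩
  refine ⟨?_, ?_⟩
  · have := hγ 1
    rwa [γ.target] at this
  · rwa [localFun_extend hg x γ hγ]

lemma measurable_localFun (hg : IsStarPhase ε g) : Measurable (localFun ε g) := by
  intro S _
  have hA : MeasurableSet {x : Cover n | x.proj ∈ projNbhd n} := by
    simpa using (isOpen_localFun hg Set.univ).measurableSet
  have hS := (isOpen_localFun hg S).measurableSet
  by_cases h0 : (0 : ℂ) ∈ S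
  · convert hS.union hA.compl using 1
    ext x
    by_cases hx : x.proj ∈ projNbhd n <;> simp [hx, localFun, h0]
  · convert hS using 1
    ext x
    by_cases hx : x.proj ∈ projNbhd n <;> simp [hx, localFun, h0]

lemma localFun_act (x : Cover n) (b : Braid n) :
    localFun ε g (x.act b⁻¹) = ε b * localFun ε g x := by
  by_cases hx : x.proj ∈ projNbhd n
  · have hx' : (x.act b⁻¹).proj ∈ projNbhd n := hx
    rw [localFun, localFun, if_pos hx, if_pos hx', ← Circle.coe_mul]
    congr 1
    change g (numbering x.proj).1 * (phase ε (Path.Homotopic.Quotient.trans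
      (FundamentalGroup.toPath b⁻¹) x.2))⁻¹ = _
    rw [phase_trans, phase_fromPath]
    change _ * (ε b⁻¹ * _)⁻¹ = _
    rw [map_inv, mul_inv, inv_inv, mul_left_comm]
  · have hx' : (x.act b⁻¹).proj ∉ projNbhd n := hx
    rw [localFun, localFun, if_neg hx, if_neg hx', mul_zero]

lemma measurableSet_projNbhd (n : ℕ) : MeasurableSet (projNbhd n) :=
  measurableSet_quotient.2 ((isOpen_projNbhd n).preimage (continuous_proj n)).measurableSet

lemma measX_projNbhd (n : ℕ) : measX n (projNbhd n) = (n.factorial : ENNReal)⁻¹ *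
    (volume : Measure (Fin n → ℂ)) (Subtype.val '' (proj n ⁻¹' projNbhd n)) := by
  have he : MeasurableEmbedding (Subtype.val : Y n → (Fin n → ℂ)) :=
    MeasurableEmbedding.subtype_coe (isOpen_injective n).measurableSet
  rw [measX, Measure.smul_apply, Measure.map_apply (measurable_proj n) (measurableSet_projNbhd n),
    he.comap_apply, smul_eq_mul]

lemma measX_projNbhd_lt_top (n : ℕ) : measX n (projNbhd n) < ⊤ := by
  rw [measX_projNbhd]
  refine ENNReal.mul_lt_top (by simp [n.factorial_pos]) ?_
  -- The preimage consists of all renumberings of `nbhd n`; their coordinates have norm at most `n +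
  -- 1/3`.
  refine (measure_mono ?_).trans_lt
    (measure_closedBall_lt_top (x := (0 : Fin n → ℂ)) (r := (n : ℝ) + 1))
  rintro _ ⟨y, ⟨z, hz, h⟩, rfl⟩
  obtain ⟨π, rfl⟩ := Quotient.exact (s := permSetoid n) h
  rw [mem_closedBall_zero_iff, pi_norm_le_iff_of_nonneg (by positivity)]
  intro k
  have h1 := mem_nbhd.1 hz (π k)
  have h2 : ‖(((π k : Fin n) : ℕ) : ℂ)‖ ≤ n := by
    rw [Complex.norm_natCast]
    exact_mod_cast (π k).2.le
  have h3 := norm_le_norm_add_norm_sub' (z.1 (π k)) (((π k : Fin n) : ℕ) : ℂ)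
  rw [dist_eq_norm] at h1
  change ‖z.1 (π k)‖ ≤ _
  linarith

lemma measX_projNbhd_pos (n : ℕ) : 0 < measX n (projNbhd n) := by
  rw [measX_projNbhd]
  refine ENNReal.mul_pos (by simp) (ne_of_gt ?_)
  refine IsOpen.measure_pos _ ?_ ⟨_, baseY n, ⟨_, baseY_mem_nbhd n, rfl⟩, rfl⟩
  exact (isOpen_injective n).isOpenMap_subtype_val _
    ((isOpen_projNbhd n).preimage (continuous_proj n))

lemma localFun_mem_waveFun (hg : IsStarPhase ε g) : localFun ε g ∈ waveFun ε := by
  refine ⟨measurable_localFun hg, fun b x => localFun_act x b, (projNbhd n).indicator 1,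
    measurable_one.indicator (measurableSet_projNbhd n), fun x => ?_, ?_⟩
  · by_cases hx : x.proj ∈ projNbhd n
    · rw [localFun, if_pos hx, Set.indicator_of_mem hx, ← ofReal_norm, Circle.norm_coe]
      simp
    · simp [localFun, hx]
  · rw [lintegral_indicator_one (measurableSet_projNbhd n)]
    exact measX_projNbhd_lt_top n

end

/-- The function `localFun` has modulus `1` over a set of positive, finite measure. -/
instance {n : ℕ} (ε : Braid n →* Circle) : Nontrivial (L2 ε) := by
  obtain ⟨g, hg⟩ := exists_isStarPhase ε
  refine ⟨Submodule.Quotient.mk ⟨localFun ε g, localFun_mem_waveFun hg⟩, 0, fun h => ?_⟩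
  rw [Submodule.Quotient.mk_eq_zero] at h
  have h' : ∀ᵐ p ∂(measX n), ∀ x : Cover n, x.proj = p → localFun ε g x = 0 := h
  refine (measX_projNbhd_pos n).ne' (measure_mono_null (fun p hp => ?_) (ae_iff.1 h'))
  simp only [Set.mem_ofPred_eq, not_forall]
  refine ⟨⟨p, joinClass (joined_base hp)⟩, rfl, ?_⟩
  have hp' : Cover.proj (⟨p, joinClass (joined_base hp)⟩ : Cover n) ∈ projNbhd n := hp
  unfold localFun
  rw [if_pos hp']
  exact Circle.coe_ne_zero _

end Anyon

end

/-! ### Comparison of the two scalars -/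

theorem theorem2 (κ : Circle) (s : ℝ) (hs : Complex.exp (2 * Real.pi * Complex.I * s) = κ)
    (n : ℕ) (ε : Anyon.Braid n →* Circle) (hε : Anyon.HasStatisticsPhase ε κ)
    (ε' : Anyon.Braid (2 * n) →* Circle) (hε' : Anyon.HasStatisticsPhase ε' κ) (sₙ : ℝ) :
    Anyon.D ε sₙ (2 * Real.pi) =
        ((Anyon.clusterPhase ε' : Circle) : ℂ) • (LinearMap.id : Anyon.L2 ε →ₗ[ℂ] Anyon.L2 ε) ↔
      ∃ k : ℤ, sₙ = n * s + k := by
  have hid : (LinearMap.id : Anyon.L2 ε →ₗ[ℂ] Anyon.L2 ε) ≠ 0 := fun h => by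
    obtain ⟨φ, hφ⟩ := exists_ne (0 : Anyon.L2 ε)
    exact hφ (LinearMap.congr_fun h φ)
  -- Subtraction is truncated, so `n = 0` is treated separately. After cancelling `κ^(n(n-1))`, the
  -- factor `κ^n` remains on the cluster side.
  have hn : n * n = n * (n - 1) + n := by
    rcases n with _ | n
    · rfl
    · rw [Nat.add_sub_cancel]; ring
  rw [Anyon.D_two_pi, Anyon.phase_rotPath_two_pi hε, Anyon.clusterPhase_eq hε',
    (smul_left_injective ℂ hid).eq_iff, hn, pow_add, Circle.coe_mul, mul_comm,
    mul_right_inj' (Circle.coe_ne_zero _), Circle.coe_pow, ← hs, ← Complex.exp_nat_mul,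
    Complex.exp_eq_exp_iff_exists_int]
  refine exists_congr fun k => ?_
  have h2 : (2 * Real.pi * Complex.I : ℂ) ≠ 0 := Complex.two_pi_I_ne_zero
  have h3 : (n : ℂ) * (2 * Real.pi * Complex.I * s) + k * (2 * Real.pi * Complex.I) =
      2 * Real.pi * Complex.I * ((n * s + k : ℝ) : ℂ) := by
    push_cast
    ring
  rw [h3, mul_right_inj' h2, Complex.ofReal_inj]
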